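/- Let $M$ be a smooth manifold modelled on a real Hilbert space $\mathbb H$, with a weak Riemannian metric $\langle\cdot,\cdot\rangle$: a smooth choice, for every $x\in M$, of a continuous, symmetric, positive definite bilinear form on $T_xM$, which need not induce the topology $\tau$ that $T_xM$ has from the charts. Assume that the metric has a smooth Levi-Civita connection $\nabla$, with curvature $R(X,Y)Z=\nabla_X\nabla_YZ-\nabla_Y\nabla_XZ-\nabla_{[X,Y]}Z$. Let $S$ and $\Sigma$ be submanifolds of $M$ of codimension one and let $p\in S\cap\Sigma$ be such that $V:=T_pS=T_p\Sigma$ is a closed subspace of $(T_pM,\tau)$. Let $N$ and $\overline N$ be smooth nowhere vanishing normal vector fields along $S$ and $\Sigma$ with $N(p)=\overline N(p)=:\xi$, so that $T_pM=V\oplus\mathbb R\xi$; let $P$ be the projection of $T_pM$ onto $V$ along $\xi$, and let $A X=-P(\nabla_XN)$ and $\overline A X=-P(\nabla_X\overline N)$, $X\in V$, be the Weingarten operators of $S$ and $\Sigma$ at $p$. Let $b>0$ and let $c:[0,b]\to M$ be a geodesic with $c(0)=p$ and $\dot c(0)=\xi$. With the parallel transport $P_t:T_pM\to T_{c(t)}M$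 along $c$, put $R_t(X)=P_t^{-1}\big(R(P_tX,\dot c(t))\dot c(t)\big)$ for $X\in T_pM$. The Jacobi flow of $S$ is the solution $T$ on $[0,b]$, in the bounded operators of $(T_pM,\tau)$, of $$T''(t)+R_t\,T(t)=0,\qquad T(0)(v+w)=v,\qquad T'(0)(v+w)=-Av+w\qquad(v\in V,\ w\in\mathbb R\xi),$$ and the Jacobi flow $\overline T$ of $\Sigma$ is defined in the same way with $\overline A$ in place of $A$. Suppose that $\langle\nabla_XN,X\rangle<\langle\nabla_X\overline N,X\rangle$ for every $X\in V$ with $X\neq0$, and that $T(t)$ is invertible (an isomorphism of $(T_pM,\tau)$) for every $t\in(0,b)$. Then: 1. $\overline T(t)$ is injective for every $t\in(0,b)$. 2. If moreover $M$ is a (strong) Riemannian Hilbert manifold, that is, $\langle\cdot,\cdot\rangle$ induces the topology $\tau$ on every tangent space, and $A-\overline A:V\to V$ is invertible, then $\overline T(t)$ is invertible for every $t\in(0,b)$. -/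

import Mathlib

open Set Filter
open scoped Manifold ContDiff Topology Bundle

noncomputable section

namespace WeakRiem

/-- A weak Riemannian metric on a manifold `M` modelled on a Hilbert space `H`: a smooth assignment
of a continuous, symmetric, positive definite bilinear form to every tangent space. Nothing says
that the form induces the topology of the tangent space. -/
structure WeakRiemannianMetric (H : Type*) [NormedAddCommGroup H] [InnerProductSpace ℝ H]
    (M : Type*) [TopologicalSpace M] [ChartedSpace H M] [IsManifold 𝓘(ℝ, H) ∞ M] where
  inner : ∀ x : M, TangentSpace 𝓘(ℝ, H) x →L[ℝ] TangentSpace 𝓘(ℝ, H) x →L[ℝ] ℝ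
  symm : ∀ (x : M) (v w : TangentSpace 𝓘(ℝ, H) x), inner x v w = inner x w v
  pos : ∀ (x : M) (v : TangentSpace 𝓘(ℝ, H) x), v ≠ 0 → 0 < inner x v v
  contMDiff : ContMDiff 𝓘(ℝ, H) (𝓘(ℝ, H).prod 𝓘(ℝ, H →L[ℝ] H →L[ℝ] ℝ)) ∞
    (fun x : M => Bundle.TotalSpace.mk' (H →L[ℝ] H →L[ℝ] ℝ)
      (E := fun x : M => TangentSpace 𝓘(ℝ, H) x →L[ℝ] TangentSpace 𝓘(ℝ, H) x →L[ℝ] ℝ) x (inner x))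

variable {H : Type*} [NormedAddCommGroup H] [InnerProductSpace ℝ H]
  {M : Type*} [TopologicalSpace M] [ChartedSpace H M]

/-- The coordinates in the chart `e` of a tangent vector `v` at `x`. -/
def coord (e : OpenPartialHomeomorph M H) (x : M) (v : TangentSpace 𝓘(ℝ, H) x) : H :=
  mfderiv 𝓘(ℝ, H) 𝓘(ℝ, H) e x v

/-- The tangent vector at `e.symm y` with the coordinates `u` in the chart `e`, as a continuous
linear map of `u` (every tangent space of `M` is, by Mathlib's definition, a copy of the model space
`H`, with its topology). -/
def ofCoord (e : OpenPartialHomeomorph M H) (y : H) : H →L[ℝ] H :=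
  mfderiv 𝓘(ℝ, H) 𝓘(ℝ, H) e.symm y

/-- The velocity at time `t` of a curve `c` that is defined on the set of times `s`. -/
def velocity (c : ℝ → M) (s : Set ℝ) (t : ℝ) : TangentSpace 𝓘(ℝ, H) (c t) :=
  mfderivWithin 𝓘(ℝ, ℝ) 𝓘(ℝ, H) c s t (1 : ℝ)

/-- `S` is a (smooth, embedded) submanifold of codimension one: around each of its points there is a
chart of `M` in which `S` is a translate of a closed linear subspace of codimension one. -/
def IsHypersurface (S : Set M) : Prop :=
  ∀ x ∈ S, ∃ e ∈ IsManifold.maximalAtlas 𝓘(ℝ, H) ∞ M, ∃ F : Submodule ℝ H,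
    IsClosed (F : Set H) ∧ Module.finrank ℝ (H ⧸ F) = 1 ∧ x ∈ e.source ∧
      ∀ y ∈ e.source, (y ∈ S ↔ e y - e x ∈ F)

/-- The tangent vectors at `x` of a subset `S` of `M`: the velocities at time `0` of the
smooth curves in `S` that are at `x` at time `0`. -/
def tangentVectors (S : Set M) (x : M) : Set (TangentSpace 𝓘(ℝ, H) x) :=
  {v | ∃ γ : ℝ → M, ContMDiffAt 𝓘(ℝ, ℝ) 𝓘(ℝ, H) ∞ γ 0 ∧ (∀ᶠ t in 𝓝 (0 : ℝ), γ t ∈ S) ∧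
    γ 0 = x ∧ v = mfderiv 𝓘(ℝ, ℝ) 𝓘(ℝ, H) γ 0 (1 : ℝ)}

variable [IsManifold 𝓘(ℝ, H) ∞ M]

namespace WeakRiemannianMetric

variable (g : WeakRiemannianMetric H M)

/-- The metric makes `M` a (strong) Riemannian Hilbert manifold: in every tangent space the unit
ball of the metric is bounded, so that the metric induces the topology of the tangent space. -/
def IsStrong : Prop :=
  ∀ x : M, Bornology.IsVonNBounded ℝ {v : TangentSpace 𝓘(ℝ, H) x | g.inner x v v < 1}

/-- The metric read in the chart `e`, as a function of the coordinates `y` of the base point. -/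
def inChart (e : OpenPartialHomeomorph M H) (y : H) : H →L[ℝ] H →L[ℝ] ℝ :=
  let G : H →L[ℝ] H →L[ℝ] ℝ := g.inner (e.symm y)
  G.bilinearComp (ofCoord e y) (ofCoord e y)

/-- `B` is the Christoffel symbol at `y` of the Levi-Civita connection in the chart `e`. The
connection is `∇_u v = D v (u) + B (u, v)` in this chart; it has no torsion if `B` is symmetric, and
it is metric if `D g (u) (v, w) = g (B (u, v), w) + g (v, B (u, w))`. By the positivity of `g`
there is at most one such `B`. -/
structure IsLeviCivitaAt (e : OpenPartialHomeomorph M H) (y : H) (B : H →L[ℝ] H →L[ℝ] H) :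
    Prop where
  torsion_free : ∀ u v, B u v = B v u
  metric : ∀ u v w, fderiv ℝ (g.inChart e) y u v w =
    g.inChart e y (B u v) w + g.inChart e y v (B u w)

open Classical in
/-- The Christoffel symbol of the Levi-Civita connection in the chart `e` (zero at the points where
there is none, which the existence of a Levi-Civita connection excludes). -/
def christoffel (e : OpenPartialHomeomorph M H) (y : H) : H →L[ℝ] H →L[ℝ] H :=
  if h : ∃ B, g.IsLeviCivitaAt e y B then h.choose else 0

/-- The metric has a smooth Levi-Civita connection. -/
def HasSmoothLeviCivita : Prop :=
  ∀ e ∈ atlas H M, (∀ y ∈ e.target, ∃ B, g.IsLeviCivitaAt e y B) ∧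
    ContDiffOn ℝ ∞ (g.christoffel e) e.target

/-- The curvature tensor `R(u, v) w = ∇_u ∇_v w - ∇_v ∇_u w - ∇_[u, v] w` at `x`, computed in the
chart at `x`. -/
def curvature (x : M) (u v w : TangentSpace 𝓘(ℝ, H) x) : TangentSpace 𝓘(ℝ, H) x :=
  let e := chartAt H x
  let Γ := g.christoffel e
  let y := e x
  let u' := coord e x u
  let v' := coord e x v
  let w' := coord e x w
  ofCoord e y (fderiv ℝ Γ y u' v' w' - fderiv ℝ Γ y v' u' w'
    + Γ y u' (Γ y v' w') - Γ y v' (Γ y u' w'))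

/-- The vector field `V` along the curve `c`, defined on the set of times `s`, is parallel: its
covariant derivative along `c` vanishes. In the chart at `c t` the covariant derivative at the
time `t` is `V' + Γ (c', V)`. -/
def IsParallelAlong (c : ℝ → M) (s : Set ℝ) (V : ∀ t, TangentSpace 𝓘(ℝ, H) (c t)) : Prop :=
  ∀ t ∈ s,
    HasDerivWithinAt (fun r => coord (chartAt H (c t)) (c r) (V r))
      (-(g.christoffel (chartAt H (c t)) (chartAt H (c t) (c t))
        (coord (chartAt H (c t)) (c t) (velocity c s t))
        (coord (chartAt H (c t)) (c t) (V t)))) s t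

/-- `c` is a geodesic on the set of times `s`. -/
def IsGeodesicOn (c : ℝ → M) (s : Set ℝ) : Prop :=
  ContMDiffOn 𝓘(ℝ, ℝ) 𝓘(ℝ, H) ∞ c s ∧ g.IsParallelAlong c s (velocity c s)

/-- `P t` is, for `t ∈ s`, the parallel transport along `c` from the time `0` to the time `t`. -/
def IsParallelTransport (c : ℝ → M) (s : Set ℝ)
    (P : ∀ t, TangentSpace 𝓘(ℝ, H) (c 0) ≃L[ℝ] TangentSpace 𝓘(ℝ, H) (c t)) : Prop :=
  (∀ v, P 0 v = v) ∧ ∀ v, g.IsParallelAlong c s (fun t => P t v)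

/-- `N` is a smooth nowhere vanishing normal vector field along `S`. -/
structure IsNormalField (S : Set M) (N : ∀ x : M, TangentSpace 𝓘(ℝ, H) x) : Prop where
  smooth : ContMDiffOn 𝓘(ℝ, H) 𝓘(ℝ, H).tangent ∞
    (fun x => (⟨x, N x⟩ : TangentBundle 𝓘(ℝ, H) M)) S
  normal : ∀ x ∈ S, ∀ v ∈ tangentVectors S x, g.inner x (N x) v = 0
  ne_zero : ∀ x ∈ S, N x ≠ 0

/-- The covariant derivative `∇_X N` at `p ∈ S` of a vector field `N` along `S`, in the direction of
a vector `X` tangent to `S`; in the chart at `p` it is `D N (X) + Γ (X, N)`, where the derivative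
of `N` is taken within `S`. -/
def covDerivOn (S : Set M) (N : ∀ x : M, TangentSpace 𝓘(ℝ, H) x) (p : M)
    (X : TangentSpace 𝓘(ℝ, H) p) : TangentSpace 𝓘(ℝ, H) p :=
  let e := chartAt H p
  ofCoord e (e p)
    (fderivWithin ℝ (fun y => coord e (e.symm y) (N (e.symm y))) (e.target ∩ e.symm ⁻¹' S) (e p)
        (coord e p X)
      + g.christoffel e (e p) (coord e p X) (coord e p (N p)))

/-- The Weingarten operator `A X = - P (∇_X N)` at `p` of the hypersurface `S` with normal field
`N`; `P` is the projection onto the tangent space of `S` along its normal line, which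
is spanned by `N p`. -/
def weingarten (S : Set M) (N : ∀ x : M, TangentSpace 𝓘(ℝ, H) x) (p : M)
    (X : TangentSpace 𝓘(ℝ, H) p) : TangentSpace 𝓘(ℝ, H) p :=
  -(g.covDerivOn S N p X
    - (g.inner p (g.covDerivOn S N p X) (N p) / g.inner p (N p) (N p)) • N p)

/-- The operator `R_t (X) = P_t⁻¹ (R (P_t X, c' t) (c' t))` of the tangent space at `c 0`. -/
def jacobiOperator (c : ℝ → M) (s : Set ℝ)
    (P : ∀ t, TangentSpace 𝓘(ℝ, H) (c 0) ≃L[ℝ] TangentSpace 𝓘(ℝ, H) (c t)) (t : ℝ)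
    (X : TangentSpace 𝓘(ℝ, H) (c 0)) : TangentSpace 𝓘(ℝ, H) (c 0) :=
  (P t).symm (g.curvature (c t) (P t X) (velocity c s t) (velocity c s t))

/-- `T` is the Jacobi flow on `[0, b]` of the normal geodesic `c` relative to the hypersurface `S`
with normal field `N`: the solution, in the bounded operators of the tangent space at `c 0`, of
`T'' + R_t T = 0`, `T(0) (v + w) = v`, `T'(0) (v + w) = - A v + w` for `v` tangent and `w` normal
to `S`. The tangent space at `c 0` is, by Mathlib's definition, a copy of the
model space `H`, with its topology. -/
def IsJacobiFlow (c : ℝ → M) (b : ℝ) (S : Set M) (N : ∀ x : M, TangentSpace 𝓘(ℝ, H) x)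
    (T : ℝ → H →L[ℝ] H) : Prop :=
  ∃ P : ∀ t, TangentSpace 𝓘(ℝ, H) (c 0) ≃L[ℝ] TangentSpace 𝓘(ℝ, H) (c t),
    g.IsParallelTransport c (Icc 0 b) P ∧
  ∃ T₁ T₂ : ℝ → H →L[ℝ] H,
    (∀ t ∈ Icc 0 b, HasDerivWithinAt T (T₁ t) (Icc 0 b) t) ∧
    (∀ t ∈ Icc 0 b, HasDerivWithinAt T₁ (T₂ t) (Icc 0 b) t) ∧
    (∀ t ∈ Icc 0 b, ∀ u : H, T₂ t u = -g.jacobiOperator c (Icc 0 b) P t (T t u)) ∧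
    (∀ v ∈ tangentVectors S (c 0), T 0 v = v ∧ T₁ 0 v = -g.weingarten S N (c 0) v) ∧
    (∀ w : TangentSpace 𝓘(ℝ, H) (c 0), (∀ v ∈ tangentVectors S (c 0), g.inner (c 0) w v = 0) →
      T 0 w = 0 ∧ T₁ 0 w = w)

end WeakRiemannianMetric

end WeakRiem

end

/-! The argument is a Wronskian comparison that never needs completeness of the weak metric. Write
`G` for the metric at `c 0`, `T` and `U` for the two flows, `e = U' 0 - T' 0`, and for fixed `u` put
`Y t = (T t)⁻¹ (U t u)`. The operators `R_t` are `G`-symmetric, so Wronskians of solutions are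
constant. Evaluating that of `U, T` on `(u, Y')`, subtracting that of `T, T` on `(Y, Y')`, and using
`T' Y + T Y' = U' u`, one gets `G (e u) Y' = G (T Y') (T Y') ≥ 0`. Hence `G (e u) (Y t)` is
nondecreasing. Although `T 0` is only a projection, `Y t → u` as `t → 0⁺`, so `G (e u) u ≤ G (e u)
(Y t)`; and if `e u = 0`, then `Y' = 0` and `Y` is constantly `u`. This is
`IsJacobiSolution.comparison`. If `U t u = 0`, then `G (e u) u ≤ 0`, so `u` is normal because `e` is
positive on `V`; then `e u = 0` and `u = Y t = 0`. This is injectivity. For a strong metric and `e`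
bijective on `V`, the form `G (e ·) ·` is coercive on `V`, and by the comparison so is `G (e v) (B
w)` with `B = (T t)⁻¹ (U t)`. Lax–Milgram makes `B` surjective modulo normal vectors, which `B`
fixes. The geometric input is: symmetry of `R_t` (`HasSmoothLeviCivita.jacobiOperator_symm`, from
the curvature symmetries and isometry of parallel transport), symmetry of the second fundamental
form (`HasSmoothLeviCivita.covDerivOn_symm`), and the splitting of the tangent space into `V` and
the normal line (`IsNormalField.sub_smul_mem`). -/

namespace WeakRiem

/-! ### Comparison of two operator solutions of the Jacobi equation -/

section Jacobi

variable {E : Type*} [NormedAddCommGroup E] [NormedSpace ℝ E]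

/-- `T` solves `T'' + R T = 0` on `[0, b]`, with derivatives `T₁` and `T₂`. -/
structure IsJacobiSolution (R : ℝ → E → E) (b : ℝ) (T T₁ T₂ : ℝ → E →L[ℝ] E) : Prop where
  deriv : ∀ t ∈ Icc 0 b, HasDerivWithinAt T (T₁ t) (Icc 0 b) t
  deriv₁ : ∀ t ∈ Icc 0 b, HasDerivWithinAt T₁ (T₂ t) (Icc 0 b) t
  eq : ∀ t ∈ Icc 0 b, ∀ u, T₂ t u = -R t (T t u)

/-- The Wronskian of two solutions of the Jacobi equation is constant. -/
theorem IsJacobiSolution.wronskian {R : ℝ → E → E} {b : ℝ} {T T₁ T₂ U U₁ U₂ : ℝ → E →L[ℝ] E}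
    (hT : IsJacobiSolution R b T T₁ T₂) (hU : IsJacobiSolution R b U U₁ U₂)
    (G : E →L[ℝ] E →L[ℝ] ℝ)
    (hR : ∀ t ∈ Icc 0 b, ∀ x y, G (R t x) y = G x (R t y))
    (u a : E) {t : ℝ} (ht : t ∈ Icc 0 b) :
    G (U₁ t u) (T t a) - G (U t u) (T₁ t a) = G (U₁ 0 u) (T 0 a) - G (U 0 u) (T₁ 0 a) := by
  have key : ∀ s ∈ Icc 0 b, HasDerivWithinAt
      (fun s => G (U₁ s u) (T s a) - G (U s u) (T₁ s a)) 0 (Icc 0 b) s := by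
    intro s hs
    have ev : ∀ {F : ℝ → E →L[ℝ] E} {F' : E →L[ℝ] E}, HasDerivWithinAt F F' (Icc 0 b) s →
        ∀ x, HasDerivWithinAt (fun r => F r x) (F' x) (Icc 0 b) s := fun h x => by
      simpa using h.clm_apply (hasDerivWithinAt_const s (Icc 0 b) x)
    have bil : ∀ {p q : ℝ → E} {p' q' : E}, HasDerivWithinAt p p' (Icc 0 b) s →
        HasDerivWithinAt q q' (Icc 0 b) s →
        HasDerivWithinAt (fun r => G (p r) (q r)) (G p' (q s) + G (p s) q') (Icc 0 b) s :=
      fun hp hq => ((G.hasFDerivAt.comp_hasDerivWithinAt s hp).clm_apply hq)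
    have h := (bil (ev (hU.deriv₁ s hs) u) (ev (hT.deriv s hs) a)).sub
      (bil (ev (hU.deriv s hs) u) (ev (hT.deriv₁ s hs) a))
    refine h.congr_deriv ?_
    rw [hU.eq s hs, hT.eq s hs]
    have := hR s hs (U s u) (T s a)
    simp only [map_neg, neg_apply]
    linarith
  refine constant_of_derivWithin_zero (fun s hs => (key s hs).differentiableWithinAt) ?_ t ht
  intro s hs
  have hs' : s ∈ Icc 0 b := Ico_subset_Icc_self hs
  exact (key s hs').derivWithin (uniqueDiffOn_Icc (hs.1.trans_lt hs.2) s hs')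

/-- A differentiable family of operators `T` with `T 0` a projection whose derivative is the identity
modulo the range of `T 0` grows at least linearly. -/
theorem exists_mul_norm_le {T : ℝ → E →L[ℝ] E} {L : E →L[ℝ] E} {b : ℝ} (hb : 0 < b)
    (hT : HasDerivWithinAt T L (Icc 0 b) 0)
    (hP : ∀ x, T 0 (T 0 x) = T 0 x) (hQ : ∀ x, L x - T 0 (L x) = x - T 0 x)
    (hL : ∀ x, T 0 (L x) = T 0 (L (T 0 x))) :
    ∃ c > 0, ∀ᶠ t in 𝓝[>] (0 : ℝ), ∀ x, c * t * ‖x‖ ≤ ‖T t x‖ := by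
  set P := T 0 with hPdef
  set Q : E →L[ℝ] E := ContinuousLinearMap.id ℝ E - P with hQdef
  -- `K` is such that `t ‖x‖ ≤ K ‖P x + t L x‖` for small `t`; the `+ 1` only makes it positive. The
  -- remainder of `T` at `0` is then kept below half of `t ‖x‖ / K`.
  set K : ℝ := 2 * ‖P‖ + ‖Q‖ + 1 with hK
  have hK0 : 0 < K := by positivity
  have hnhds : 𝓝[>] (0 : ℝ) ≤ 𝓝[Icc 0 b] 0 := by
    rw [← nhdsWithin_Ioo_eq_nhdsGT hb]
    exact nhdsWithin_mono _ Ioo_subset_Icc_self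
  have hrem : ∀ᶠ t in 𝓝[>] (0 : ℝ), ‖T t - T 0 - (t - 0) • L‖ ≤ (1 / (2 * K)) * ‖t - 0‖ :=
    (hasDerivWithinAt_iff_isLittleO.1 hT).bound (by positivity) |>.filter_mono hnhds
  have hsmall : ∀ᶠ t in 𝓝[>] (0 : ℝ), t < min 1 (1 / (2 * (‖P.comp L‖ + 1))) :=
    mem_nhdsWithin_of_mem_nhds (Iio_mem_nhds (by positivity))
  refine ⟨1 / (2 * K), by positivity, ?_⟩
  filter_upwards [hrem, hsmall, self_mem_nhdsWithin] with t h1 h2 h3 x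
  have ht0 : 0 < t := h3
  have ht1 : t ≤ 1 := (h2.trans_le (min_le_left _ _)).le
  have ht2 : t * ‖P.comp L‖ ≤ 1 / 2 := by
    have := h2.trans_le (min_le_right _ _)
    rw [lt_div_iff₀ (by positivity)] at this
    nlinarith [norm_nonneg (P.comp L)]
  rw [sub_zero, Real.norm_of_nonneg ht0.le, ← hPdef] at h1
  set S := P x + t • L x with hS
  -- `P` recovers the tangential part of `x` from `S` up to an error that is absorbed for small `t`;
  -- `Q` recovers `t` times the normal part exactly.
  have hPS : P x = P S - t • (P.comp L) (P x) := by
    simp only [hS, map_add, map_smul, hP, ContinuousLinearMap.comp_apply, ← hL]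
    abel
  have hQS : t • (x - P x) = Q S := by
    simp only [hS, hQdef, map_add, map_smul, sub_apply,
      ContinuousLinearMap.id_apply, hP, hQ]
    simp
  have b1 : ‖P x‖ ≤ ‖P‖ * ‖S‖ + t * ‖P.comp L‖ * ‖P x‖ := by
    calc ‖P x‖ = ‖P S - t • (P.comp L) (P x)‖ := by rw [← hPS]
      _ ≤ ‖P S‖ + ‖t • (P.comp L) (P x)‖ := norm_sub_le _ _
      _ ≤ _ := by
        rw [norm_smul, Real.norm_of_nonneg ht0.le, mul_assoc]
        gcongr
        · exact P.le_opNorm S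
        · exact (P.comp L).le_opNorm _
  have b2 : ‖P x‖ ≤ 2 * ‖P‖ * ‖S‖ := by nlinarith [norm_nonneg (P x)]
  have b3 : t * ‖x - P x‖ ≤ ‖Q‖ * ‖S‖ := by
    calc t * ‖x - P x‖ = ‖t • (x - P x)‖ := by rw [norm_smul, Real.norm_of_nonneg ht0.le]
      _ ≤ _ := hQS ▸ Q.le_opNorm S
  have b4 : t * ‖x‖ ≤ K * ‖S‖ := by
    have : ‖x‖ ≤ ‖P x‖ + ‖x - P x‖ := by
      simpa using norm_add_le (P x) (x - P x)
    nlinarith [norm_nonneg (P x), norm_nonneg S]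
  have b5 : ‖S‖ ≤ ‖T t x‖ + 1 / (2 * K) * t * ‖x‖ := by
    have e : S = T t x - (T t - P - t • L) x := by
      simp only [hS, sub_apply, smul_apply]; abel
    rw [e]
    refine (norm_sub_le _ _).trans ?_
    gcongr
    exact ((T t - P - t • L).le_opNorm x).trans (by gcongr)
  have b6 : t * ‖x‖ / K ≤ ‖S‖ := by rw [div_le_iff₀ hK0]; linarith
  have : 1 / (2 * K) * t * ‖x‖ = t * ‖x‖ / K / 2 := by field_simp
  linarith

/-- The operators `T⁻¹ U` of two families with the same initial value tend to the identity. -/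
theorem tendsto_of_apply_eq {T U : ℝ → E →L[ℝ] E} {L L' : E →L[ℝ] E} {b : ℝ} (hb : 0 < b)
    (hT : HasDerivWithinAt T L (Icc 0 b) 0) (hU : HasDerivWithinAt U L' (Icc 0 b) 0)
    (h0 : U 0 = T 0)
    (hP : ∀ x, T 0 (T 0 x) = T 0 x) (hQ : ∀ x, L x - T 0 (L x) = x - T 0 x)
    (hL : ∀ x, T 0 (L x) = T 0 (L (T 0 x)))
    (u : E) (hu : T 0 ((L' - L) u) = (L' - L) u)
    {Y : ℝ → E} (hY : ∀ t ∈ Ioo 0 b, T t (Y t) = U t u) :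
    Tendsto Y (𝓝[>] 0) (𝓝 u) := by
  obtain ⟨c, hc, hlow⟩ := exists_mul_norm_le hb hT hP hQ hL
  set e := (L' - L) u with he
  have hnhds : 𝓝[>] (0 : ℝ) ≤ 𝓝[Icc 0 b] 0 := by
    rw [← nhdsWithin_Ioo_eq_nhdsGT hb]
    exact nhdsWithin_mono _ Ioo_subset_Icc_self
  have hIoo : ∀ᶠ t in 𝓝[>] (0 : ℝ), t ∈ Ioo 0 b := Ioo_mem_nhdsGT hb
  have ht0 : Tendsto (fun t : ℝ => t) (𝓝[>] 0) (𝓝 0) := tendsto_nhdsWithin_of_tendsto_nhds tendsto_id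
  have hD : Tendsto (fun t : ℝ => t⁻¹ • (U t u - T t u) - T t e) (𝓝[>] 0) (𝓝 0) := by
    have h1 : HasDerivWithinAt (fun t => U t u - T t u) e (Icc 0 b) 0 := by
      simpa [he] using (hU.sub hT).clm_apply (hasDerivWithinAt_const (0 : ℝ) (Icc 0 b) u)
    have h2 := (hasDerivWithinAt_iff_tendsto_slope.1 h1)
    have h3 : Tendsto (slope (fun t => U t u - T t u) 0) (𝓝[>] 0) (𝓝 e) := by
      refine h2.mono_left ?_
      rw [← nhdsWithin_Ioo_eq_nhdsGT hb]
      exact nhdsWithin_mono _ fun x hx => ⟨Ioo_subset_Icc_self hx, hx.1.ne'⟩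
    have h4 : Tendsto (fun t => T t e) (𝓝[>] 0) (𝓝 e) := by
      have : ContinuousWithinAt (fun t => T t e) (Icc 0 b) 0 :=
        hT.continuousWithinAt.clm_apply continuousWithinAt_const
      have h5 := this.tendsto.mono_left hnhds
      rwa [hu] at h5
    have h6 := h3.sub h4
    rw [sub_self] at h6
    refine h6.congr fun t => ?_
    simp [slope_def_module, h0]
  -- `(T t)⁻¹` may blow up like `1 / t`, so `Y t - u` is corrected by `t • e`: `T t` maps the
  -- difference to `t` times a quantity tending to `0`, and the linear lower bound cancels the
  -- factor `t`.
  have hsq : Tendsto (fun t => Y t - u - t • e) (𝓝[>] 0) (𝓝 0) := by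
    refine squeeze_zero_norm' (a := fun t : ℝ => c⁻¹ * ‖t⁻¹ • (U t u - T t u) - T t e‖) ?_ ?_
    · filter_upwards [hlow, hIoo] with t h1 h2
      have h3 := h1 (Y t - u - t • e)
      have h4 : T t (Y t - u - t • e) = t • (t⁻¹ • (U t u - T t u) - T t e) := by
        rw [smul_sub, smul_inv_smul₀ h2.1.ne']
        simp [hY t h2]
      rw [h4, norm_smul, Real.norm_of_nonneg h2.1.le] at h3
      rw [inv_mul_eq_div, le_div_iff₀ hc]
      have := h2.1
      nlinarith
    · simpa using hD.norm.const_mul c⁻¹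
  have := (hsq.add (ht0.smul_const e)).add_const u
  simp only [zero_smul, add_zero, zero_add] at this
  exact this.congr fun t => by abel

variable [CompleteSpace E]

/-- The initial data of two Jacobi flows `T`, `U`, in terms of the common initial value `P` and the
initial velocities `L`, `L'`. -/
structure IsInitialPair (G : E →L[ℝ] E →L[ℝ] ℝ) (P L L' : E →L[ℝ] E) : Prop where
  proj : ∀ x, P (P x) = P x
  normal : ∀ x, L x - P (L x) = x - P x
  tangent : ∀ x, P (L x) = P (L (P x))
  diff_mem : ∀ x, P ((L' - L) x) = (L' - L) x
  diff_proj : ∀ x, (L' - L) (P x) = (L' - L) x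
  lagrange : ∀ x y, G (L x) (P y) = G (P x) (L y)
  lagrange_diff : ∀ x y, G (L' x) (P y) - G (P x) (L y) = G ((L' - L) x) y
  diff_pos : ∀ x, P x ≠ 0 → 0 < G ((L' - L) x) x

variable {G : E →L[ℝ] E →L[ℝ] ℝ} {R : ℝ → E → E} {b : ℝ} {T T₁ T₂ U U₁ U₂ : ℝ → E →L[ℝ] E}

/-- The comparison inequality behind the theorem, together with the case of equality. -/
theorem IsJacobiSolution.comparison (hb : 0 < b)
    (hT : IsJacobiSolution R b T T₁ T₂) (hU : IsJacobiSolution R b U U₁ U₂)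
    (hpos : ∀ x, x ≠ 0 → 0 < G x x)
    (hR : ∀ t ∈ Icc 0 b, ∀ x y, G (R t x) y = G x (R t y)) (h0 : U 0 = T 0)
    (hI : IsInitialPair G (T 0) (T₁ 0) (U₁ 0))
    (hinv : ∀ t ∈ Ioo 0 b, (T t).IsInvertible) (u : E) {Y : ℝ → E}
    (hY : ∀ t, Y t = Ring.inverse (T t) (U t u)) {t : ℝ} (ht : t ∈ Ioo 0 b) :
    G ((U₁ 0 - T₁ 0) u) u ≤ G ((U₁ 0 - T₁ 0) u) (Y t) ∧ ((U₁ 0 - T₁ 0) u = 0 → Y t = u) := by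
  set e := (U₁ 0 - T₁ 0) u with he
  have hunit : ∀ s ∈ Ioo 0 b, IsUnit (T s) := fun s hs =>
    (hinv s hs).elim fun m hm => hm ▸ ((ContinuousLinearEquiv.unitsEquiv ℝ E).symm m).isUnit
  have hTY : ∀ s ∈ Ioo 0 b, T s (Y s) = U s u := fun s hs => by
    rw [hY, ← mul_apply_eq_comp, Ring.mul_inverse_cancel _ (hunit s hs)]; rfl
  have dT : ∀ s ∈ Ioo 0 b, HasDerivAt T (T₁ s) s := fun s hs =>
    (hT.deriv s (Ioo_subset_Icc_self hs)).hasDerivAt (Icc_mem_nhds hs.1 hs.2)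
  have dU : ∀ s ∈ Ioo 0 b, HasDerivAt (fun r => U r u) (U₁ s u) s := fun s hs => by
    simpa using ((hU.deriv s (Ioo_subset_Icc_self hs)).hasDerivAt
      (Icc_mem_nhds hs.1 hs.2)).clm_apply (hasDerivAt_const s u)
  have dY : ∀ s ∈ Ioo 0 b, DifferentiableAt ℝ Y s := fun s hs => by
    have h1 : DifferentiableAt ℝ (fun r => Ring.inverse (T r)) s :=
      (differentiableAt_inverse (𝕜 := ℝ) (hunit s hs)).comp s (dT s hs).differentiableAt
    have h2 := h1.clm_apply (dU s hs).differentiableAt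
    exact h2.congr_of_eventuallyEq (Eventually.of_forall hY)
  have hlim : Tendsto Y (𝓝[>] 0) (𝓝 u) :=
    tendsto_of_apply_eq hb (hT.deriv 0 (left_mem_Icc.2 hb.le)) (hU.deriv 0 (left_mem_Icc.2 hb.le))
      h0 hI.proj hI.normal hI.tangent u (hI.diff_mem u) hTY
  -- The central identity: `h3` is the mixed Wronskian on `(u, Y')`, `h4` that of `T` with itself on
  -- `(Y, Y')`, which vanishes since the initial data of `T` are Lagrangian.
  have hderiv : ∀ s ∈ Ioo 0 b, G e (_root_.deriv Y s) = G (T s (_root_.deriv Y s)) (T s (_root_.deriv Y s)) := by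
    intro s hs
    have hs' := Ioo_subset_Icc_self hs
    have h1 := (dT s hs).clm_apply (dY s hs).hasDerivAt
    have h2 : T₁ s (Y s) + T s (_root_.deriv Y s) = U₁ s u :=
      h1.unique ((dU s hs).congr_of_eventuallyEq
        (by filter_upwards [Ioo_mem_nhds hs.1 hs.2] with r hr using hTY r hr))
    have h3 := hT.wronskian hU G hR u (_root_.deriv Y s) hs'
    have h4 := hT.wronskian hT G hR (Y s) (_root_.deriv Y s) hs'
    rw [h0, hI.lagrange_diff, ← h2, ← hTY s hs] at h3
    rw [hI.lagrange, sub_self] at h4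
    rw [map_add, add_apply] at h3
    linarith
  have hmem : Ioo 0 b ∈ 𝓝[>] (0 : ℝ) := Ioo_mem_nhdsGT hb
  constructor
  · have df : ∀ s ∈ Ioo 0 b, HasDerivAt (fun r => G e (Y r)) (G e (_root_.deriv Y s)) s := fun s hs =>
      (G e).hasFDerivAt.comp_hasDerivAt s (dY s hs).hasDerivAt
    have hmono : MonotoneOn (fun r => G e (Y r)) (Ioo 0 b) := by
      refine monotoneOn_of_deriv_nonneg (convex_Ioo 0 b)
        (fun s hs => (df s hs).continuousAt.continuousWithinAt)
        (fun s hs => ?_) (fun s hs => ?_)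
      · rw [interior_Ioo] at hs
        exact (df s hs).differentiableAt.differentiableWithinAt
      · rw [interior_Ioo] at hs
        rw [(df s hs).deriv, hderiv s hs]
        by_cases hz : T s (_root_.deriv Y s) = 0
        · simp [hz]
        · exact (hpos _ hz).le
    refine le_of_tendsto (((G e).continuous.tendsto u).comp hlim) ?_
    filter_upwards [hmem, Ioo_mem_nhdsGT ht.1] with s hs hst using hmono hs ht hst.2.le
  · intro he0
    have hz : ∀ s ∈ Ioo 0 b, _root_.deriv Y s = 0 := by
      intro s hs
      have h1 := hderiv s hs
      rw [he0, map_zero, zero_apply] at h1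
      have h2 : T s (_root_.deriv Y s) = 0 := by
        by_contra h
        exact (hpos _ h).ne h1
      obtain ⟨eq, heq⟩ := hinv s hs
      rw [← heq] at h2
      simpa using h2
    have hconst : ∀ s ∈ Ioo 0 b, Y s = Y t := fun s hs =>
      (convex_Ioo 0 b).is_const_of_fderivWithin_eq_zero (𝕜 := ℝ)
        (fun r hr => (dY r hr).differentiableWithinAt)
        (fun r hr => by
          rw [fderivWithin_of_isOpen isOpen_Ioo hr]
          ext
          simpa using hz r hr) hs ht
    refine tendsto_nhds_unique (tendsto_const_nhds.congr' ?_) hlim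
    filter_upwards [hmem] with s hs using (hconst s hs).symm

/-- A kernel vector has `Y t = 0`, so the inequality forces its tangential part to vanish, and the
equality case then gives `u = Y t = 0`. -/
theorem IsJacobiSolution.injective (hb : 0 < b)
    (hT : IsJacobiSolution R b T T₁ T₂) (hU : IsJacobiSolution R b U U₁ U₂)
    (hpos : ∀ x, x ≠ 0 → 0 < G x x)
    (hR : ∀ t ∈ Icc 0 b, ∀ x y, G (R t x) y = G x (R t y)) (h0 : U 0 = T 0)
    (hI : IsInitialPair G (T 0) (T₁ 0) (U₁ 0))
    (hinv : ∀ t ∈ Ioo 0 b, (T t).IsInvertible) {t : ℝ} (ht : t ∈ Ioo 0 b) :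
    Function.Injective (U t) := by
  refine (injective_iff_map_eq_zero (U t)).2 fun u hu => ?_
  obtain ⟨h1, h2⟩ := hT.comparison hb hU hpos hR h0 hI hinv u (fun _ => rfl) ht
  rw [hu, map_zero] at h1 h2
  rw [map_zero] at h1
  have h3 : T 0 u = 0 := by
    by_contra h
    exact absurd (hI.diff_pos u h) h1.not_gt
  exact (h2 (by rw [← hI.diff_proj, h3, map_zero])).symm

end Jacobi

/-! ### Surjectivity for a strong metric -/

section JacobiSurjective

variable {E : Type*} [NormedAddCommGroup E] [InnerProductSpace ℝ E] [CompleteSpace E]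

omit [CompleteSpace E] in
/-- A bounded operator `e` of a closed subspace `V`, bijective, symmetric and nonnegative with respect
to an inner product `G` that induces the topology, is coercive. -/
theorem exists_mul_sq_norm_le (G : E →L[ℝ] E →L[ℝ] ℝ) {C : ℝ} (hC : ∀ x, ‖x‖ ^ 2 ≤ C * G x x)
    (e : E →L[ℝ] E) (V : Submodule ℝ E) [CompleteSpace V] (hbij : BijOn e V V)
    (hsymm : ∀ x y, G (e x) y = G (e y) x) (hnonneg : ∀ x, 0 ≤ G (e x) x) :
    ∃ δ > 0, ∀ x ∈ V, δ * ‖x‖ ^ 2 ≤ G (e x) x := by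
  set f : V →L[ℝ] V := (e.comp V.subtypeL).codRestrict V fun x => hbij.mapsTo x.2 with hf
  have hfe : ∀ x : V, (f x : E) = e x := fun _ => rfl
  have hinj : Function.Injective f := fun x y h =>
    Subtype.ext (hbij.injOn x.2 y.2 (by simpa only [hfe] using congrArg Subtype.val h))
  have hsurj : Function.Surjective f := fun y => by
    obtain ⟨x, hx, hxy⟩ := hbij.surjOn y.2
    exact ⟨⟨x, hx⟩, Subtype.ext hxy⟩
  set F : V ≃L[ℝ] V := ContinuousLinearEquiv.ofBijective f
    (LinearMap.ker_eq_bot.2 hinj) (LinearMap.range_eq_top.2 hsurj) with hF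
  set K : ℝ := ‖(F.symm : V →L[ℝ] V)‖ with hK
  set D : ℝ := C ^ 2 * ‖G‖ * K with hD
  have hD0 : 0 ≤ D := by positivity
  refine ⟨1 / (D + 1), by positivity, fun x hx => ?_⟩
  obtain hx0 | hx0 := (norm_nonneg x).eq_or_lt'
  · rw [hx0]; simpa using hnonneg x
  set z : V := F.symm ⟨x, hx⟩ with hz
  have hez : e z = x := by
    rw [← hfe]
    exact congrArg Subtype.val (F.apply_symm_apply ⟨x, hx⟩)
  have hzn : ‖(z : E)‖ ≤ K * ‖x‖ := (F.symm : V →L[ℝ] V).le_opNorm ⟨x, hx⟩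
  -- Cauchy–Schwarz for the form `G (e ·) ·` at `z = e⁻¹ x` and `x` reads `(G x x)² ≤ G x z * G (e
  -- x) x`; boundedness of `e⁻¹` controls `G x z`.
  have cs := LinearMap.BilinForm.apply_mul_apply_le_of_forall_zero_le
    (G.comp e).toBilinForm hnonneg z x
  simp only [ContinuousLinearMap.toBilinForm_apply, ContinuousLinearMap.comp_apply, hez, hsymm x z,
    ← sq] at cs
  have hGz : G x z ≤ ‖G‖ * K * ‖x‖ ^ 2 := by
    calc G x z ≤ ‖G x z‖ := le_abs_self _
      _ ≤ ‖G‖ * ‖x‖ * ‖(z : E)‖ := G.le_opNorm₂ x z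
      _ ≤ ‖G‖ * ‖x‖ * (K * ‖x‖) := by gcongr
      _ = _ := by ring
  have h1 : (‖x‖ ^ 2) ^ 2 ≤ C ^ 2 * (G x x) ^ 2 := by
    rw [← mul_pow]
    exact pow_le_pow_left₀ (by positivity) (hC x) 2
  have h2 : (‖x‖ ^ 2) ^ 2 ≤ ‖x‖ ^ 2 * (D * G (e x) x) :=
    calc (‖x‖ ^ 2) ^ 2 ≤ C ^ 2 * (G x z * G (e x) x) := h1.trans (by gcongr)
      _ ≤ C ^ 2 * (‖G‖ * K * ‖x‖ ^ 2 * G (e x) x) := by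
        gcongr
        exact hnonneg x
      _ = _ := by rw [hD]; ring
  have h3 : ‖x‖ ^ 2 ≤ D * G (e x) x := by
    rw [sq (‖x‖ ^ 2)] at h2
    exact le_of_mul_le_mul_left h2 (by positivity)
  rw [one_div, inv_mul_le_iff₀ (by positivity)]
  linarith [hnonneg x]

variable {G : E →L[ℝ] E →L[ℝ] ℝ} {R : ℝ → E → E} {b : ℝ} {T T₁ T₂ U U₁ U₂ : ℝ → E →L[ℝ] E}

/-- Injectivity is known, so by the open mapping theorem surjectivity of `B = (T t)⁻¹ (U t)` is
enough. Lax–Milgram on `V` reaches every vector up to a normal one, and `B` is the identity on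
normal vectors. -/
theorem IsJacobiSolution.isInvertible (hb : 0 < b)
    (hT : IsJacobiSolution R b T T₁ T₂) (hU : IsJacobiSolution R b U U₁ U₂)
    (hpos : ∀ x, x ≠ 0 → 0 < G x x)
    (hR : ∀ t ∈ Icc 0 b, ∀ x y, G (R t x) y = G x (R t y)) (h0 : U 0 = T 0)
    (hI : IsInitialPair G (T 0) (T₁ 0) (U₁ 0))
    (hinv : ∀ t ∈ Ioo 0 b, (T t).IsInvertible)
    {C : ℝ} (hC : ∀ x, ‖x‖ ^ 2 ≤ C * G x x)
    (V : Submodule ℝ E) (hV : IsClosed (V : Set E))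
    (hort : ∀ x, (∀ v ∈ V, G v x = 0) → T 0 x = 0)
    (hbij : BijOn (U₁ 0 - T₁ 0) V V) (hesymm : ∀ x y, G ((U₁ 0 - T₁ 0) x) y = G ((U₁ 0 - T₁ 0) y) x)
    {t : ℝ} (ht : t ∈ Ioo 0 b) : (U t).IsInvertible := by
  have : CompleteSpace V := hV.completeSpace_coe
  set e := U₁ 0 - T₁ 0 with he
  have hnonneg : ∀ x, 0 ≤ G (e x) x := fun x => by
    by_cases hx : T 0 x = 0
    · rw [← hI.diff_proj, hx]; simp
    · exact (hI.diff_pos x hx).le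
  obtain ⟨δ, hδ, hcoer⟩ := exists_mul_sq_norm_le G hC e V hbij hesymm hnonneg
  have hunit : IsUnit (T t) :=
    (hinv t ht).elim fun m hm => hm ▸ ((ContinuousLinearEquiv.unitsEquiv ℝ E).symm m).isUnit
  set B : E →L[ℝ] E := (Ring.inverse (T t)).comp (U t) with hB
  have hTB : ∀ x, T t (B x) = U t x := fun x => by
    rw [hB, ContinuousLinearMap.comp_apply, ← mul_apply_eq_comp, Ring.mul_inverse_cancel _ hunit]
    rfl
  have hcomp := fun u => hT.comparison hb hU hpos hR h0 hI hinv u (fun _ => rfl) ht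
  set β : V →L[ℝ] V →L[ℝ] ℝ :=
    ((G.flip.comp (B.comp V.subtypeL)).flip.comp (e.comp V.subtypeL)).flip with hβ
  have hβ_apply : ∀ w v : V, β w v = G (e v) (B w) := fun _ _ => rfl
  have hβc : IsCoercive β := ⟨δ, hδ, fun x => by
    rw [hβ_apply, mul_assoc, ← sq]
    exact (hcoer x x.2).trans (hcomp x).1⟩
  have hsurjV : ∀ z : E, ∃ w ∈ V, ∀ v ∈ V, G v (B w) = G v z := by
    intro z
    -- Riesz representative of `v ↦ G (e v) z`. Solving `β w = r` tests `B w - z` against `e v`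
    -- only; surjectivity of `e` on `V` turns this into all of `V`.
    set r : V := (InnerProductSpace.toDual ℝ V).symm ((G.flip z).comp (e.comp V.subtypeL)) with hr
    refine ⟨hβc.continuousLinearEquivOfBilin.symm r, Subtype.coe_prop _, fun v hv => ?_⟩
    obtain ⟨v', hv', rfl⟩ := hbij.surjOn hv
    have h1 := hβc.continuousLinearEquivOfBilin_apply
      (hβc.continuousLinearEquivOfBilin.symm r) ⟨v', hv'⟩
    rw [ContinuousLinearEquiv.apply_symm_apply, hβ_apply, hr,
      InnerProductSpace.toDual_symm_apply] at h1
    exact h1.symm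
  have hBsurj : Function.Surjective B := by
    intro z
    obtain ⟨w, -, hw⟩ := hsurjV z
    have hn : T 0 (z - B w) = 0 := hort _ fun v hv => by rw [map_sub, hw v hv, sub_self]
    have hfix : B (z - B w) = z - B w :=
      (hcomp (z - B w)).2 (by rw [← hI.diff_proj, hn, map_zero])
    exact ⟨w + (z - B w), by rw [map_add, hfix]; abel⟩
  have hsurj : Function.Surjective (U t) := fun y => by
    obtain ⟨m, hm⟩ := hinv t ht
    obtain ⟨x, hx⟩ := hBsurj (m.symm y)
    refine ⟨x, ?_⟩
    rw [← hTB, hx, ← hm]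
    simp
  have hinj := hT.injective hb hU hpos hR h0 hI hinv ht
  exact ⟨ContinuousLinearEquiv.ofBijective (U t) (LinearMap.ker_eq_bot.2 hinj)
    (LinearMap.range_eq_top.2 hsurj), by ext; rfl⟩

end JacobiSurjective

/-! ### Tangent vectors and the metric in charts -/

section Chart

variable {H : Type*} [NormedAddCommGroup H] [InnerProductSpace ℝ H]
  {M : Type*} [TopologicalSpace M] [ChartedSpace H M]

theorem coord_sub (e : OpenPartialHomeomorph M H) (x : M) (v w : TangentSpace 𝓘(ℝ, H) x) :
    coord e x (v - w) = coord e x v - coord e x w :=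
  map_sub (mfderiv 𝓘(ℝ, H) 𝓘(ℝ, H) e x) v w

theorem coord_smul (e : OpenPartialHomeomorph M H) (x : M) (r : ℝ) (v : TangentSpace 𝓘(ℝ, H) x) :
    coord e x (r • v) = r • coord e x v :=
  map_smul (mfderiv 𝓘(ℝ, H) 𝓘(ℝ, H) e x) r v

variable [IsManifold 𝓘(ℝ, H) ∞ M]

omit [IsManifold 𝓘(ℝ, H) ∞ M] in
theorem mdifferentiable_of_mem_maximalAtlas {e : OpenPartialHomeomorph M H}
    (he : e ∈ IsManifold.maximalAtlas 𝓘(ℝ, H) ∞ M) : e.MDifferentiable 𝓘(ℝ, H) 𝓘(ℝ, H) :=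
  ⟨(contMDiffOn_of_mem_maximalAtlas he).mdifferentiableOn (by simp),
    (contMDiffOn_symm_of_mem_maximalAtlas he).mdifferentiableOn (by simp)⟩

omit [IsManifold 𝓘(ℝ, H) ∞ M] in
theorem coord_ofCoord {e : OpenPartialHomeomorph M H}
    (he : e ∈ IsManifold.maximalAtlas 𝓘(ℝ, H) ∞ M) {y : H} (hy : y ∈ e.target) (u : H) :
    coord e (e.symm y) (ofCoord e y u) = u :=
  DFunLike.congr_fun ((mdifferentiable_of_mem_maximalAtlas he).comp_symm_deriv hy) u

omit [IsManifold 𝓘(ℝ, H) ∞ M] in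
theorem ofCoord_coord {e : OpenPartialHomeomorph M H}
    (he : e ∈ IsManifold.maximalAtlas 𝓘(ℝ, H) ∞ M) {x : M} (hx : x ∈ e.source)
    (v : TangentSpace 𝓘(ℝ, H) x) : ofCoord e (e x) (coord e x v) = v :=
  DFunLike.congr_fun ((mdifferentiable_of_mem_maximalAtlas he).symm_comp_deriv hx) v

omit [IsManifold 𝓘(ℝ, H) ∞ M] in
theorem coord_ofCoord' {e : OpenPartialHomeomorph M H}
    (he : e ∈ IsManifold.maximalAtlas 𝓘(ℝ, H) ∞ M) {x : M} (hx : x ∈ e.source) (u : H) :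
    coord e x (ofCoord e (e x) u) = u := by
  have h := coord_ofCoord he (e.map_source hx) u
  rwa [e.left_inv hx] at h

namespace WeakRiemannianMetric

variable (g : WeakRiemannianMetric H M)

theorem inChart_apply {e : OpenPartialHomeomorph M H}
    (he : e ∈ IsManifold.maximalAtlas 𝓘(ℝ, H) ∞ M) {x : M} (hx : x ∈ e.source)
    (v w : TangentSpace 𝓘(ℝ, H) x) :
    g.inChart e (e x) (coord e x v) (coord e x w) = g.inner x v w := by
  have h : ∀ v w : H, g.inChart e (e x) v w
      = g.inner (e.symm (e x)) (ofCoord e (e x) v) (ofCoord e (e x) w) := fun _ _ => rfl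
  rw [h, ofCoord_coord he hx, ofCoord_coord he hx, e.left_inv hx]

theorem inner_ofCoord {e : OpenPartialHomeomorph M H}
    (he : e ∈ IsManifold.maximalAtlas 𝓘(ℝ, H) ∞ M) {x : M} (hx : x ∈ e.source)
    (u : H) (w : TangentSpace 𝓘(ℝ, H) x) :
    g.inner x (ofCoord e (e x) u) w = g.inChart e (e x) u (coord e x w) :=
  (g.inChart_apply he hx (ofCoord e (e x) u) w).symm.trans <|
    congrArg (fun z => g.inChart e (e x) z (coord e x w)) (coord_ofCoord' he hx u)

theorem inChart_symm {e : OpenPartialHomeomorph M H} {y : H} (u w : H) :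
    g.inChart e y u w = g.inChart e y w u :=
  g.symm (e.symm y) (ofCoord e y u) (ofCoord e y w)

/-- Smoothness of the metric is given in the trivializations of the bundle of bilinear forms; near
`x` these amount to pulling the form back by `ofCoord`. -/
theorem contDiffAt_inChart (x : M) :
    ContDiffAt ℝ ∞ (g.inChart (chartAt H x)) (chartAt H x x) := by
  set e := chartAt H x with he
  have h := ((contMDiffAt_hom_bundle _).1 (g.contMDiff x)).2
  have hsymm : ContMDiffAt 𝓘(ℝ, H) 𝓘(ℝ, H) ∞ e.symm (e x) :=
    contMDiffAt_symm_of_mem_maximalAtlas (IsManifold.chart_mem_maximalAtlas x)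
      (mem_chart_target H x)
  have hx : e.symm (e x) = x := e.left_inv (mem_chart_source H x)
  rw [← hx] at h
  have h2 := (h.comp (e x) hsymm).contDiffAt
  rw [hx] at h2
  refine h2.congr_of_eventuallyEq ?_
  filter_upwards [e.open_target.mem_nhds (mem_chart_target H x)] with y hy
  have hy' : e.symm y ∈ (chartAt H x).source := e.map_target hy
  ext u w
  simp only [Function.comp_apply, ContinuousLinearMap.inCoordinates]
  have hL : ∀ v : H, Bundle.Trivialization.symmL ℝ
      (trivializationAt H (TangentSpace 𝓘(ℝ, H)) x) (e.symm y) v = ofCoord e y v := by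
    intro v
    rw [TangentBundle.symmL_trivializationAt hy']
    have hr := e.right_inv hy
    simp only [ofCoord, extChartAt, mfld_simps, mfderivWithin_univ]
    rw [hr]
    rfl
  have hb : e.symm y ∈ (trivializationAt (H →L[ℝ] ℝ)
      (fun b : M => TangentSpace 𝓘(ℝ, H) b →L[ℝ] ℝ) x).baseSet := by
    simpa [hom_trivializationAt_baseSet] using hy'
  rw [ContinuousLinearMap.comp_apply, ContinuousLinearMap.comp_apply,
    Bundle.Trivialization.continuousLinearMapAt_apply,
    Bundle.Trivialization.coe_linearMapAt_of_mem _ hb]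
  simp only [hom_trivializationAt_apply, ContinuousLinearMap.inCoordinates]
  rw [ContinuousLinearMap.comp_apply, ContinuousLinearMap.comp_apply, hL, hL,
    Bundle.Trivialization.continuousLinearMapAt_apply]
  simp only [Bundle.Trivial.fiberBundle_trivializationAt', Bundle.Trivial.linearMapAt_trivialization]
  rfl

end WeakRiemannianMetric

end Chart

set_option maxSynthPendingDepth 3

/-! ### Curvature symmetries of a connection on a vector space -/

section FlatCurvature

variable {H : Type*} [NormedAddCommGroup H] [NormedSpace ℝ H]

/-- A function of four arguments with the symmetries of a curvature tensor is symmetric under the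
exchange of the pairs. -/
theorem curvature_pair_symm {X : Type*} (Q : X → X → X → X → ℝ)
    (h1 : ∀ a b c d, Q a b c d = -Q b a c d) (h2 : ∀ a b c d, Q a b c d = -Q a b d c)
    (h3 : ∀ a b c d, Q a b c d + Q b c a d + Q c a b d = 0) (a b c d : X) :
    Q a b c d = Q c d a b := by
  -- The classical octahedron argument: in a suitable combination of the four Bianchi identities,
  -- skewness cancels everything except the two wanted terms.
  linarith [h3 a b c d, h3 b c d a, h3 c d a b, h3 d a b c, h1 a b c d, h2 a b c d, h1 b c a d,
    h2 b c a d, h1 c a b d, h2 c a b d, h1 c d b a, h2 c d b a, h1 d b c a, h2 d b c a,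
    h1 d a c b, h2 d a c b, h1 a c d b, h2 a c d b, h1 a b d c, h2 a b d c, h1 b d a c, h2 b d a c,
    h1 c d a b, h2 c d a b, h1 d a b c, h2 d a b c, h2 b c d a, h1 a c b d, h2 a c b d,
    h1 b d c a, h2 b d c a]

/-- The curvature of the connection `Γ` on a vector space. -/
noncomputable def flatCurvature (Γ : H → H →L[ℝ] H →L[ℝ] H) (y u v w : H) : H :=
  fderiv ℝ Γ y u v w - fderiv ℝ Γ y v u w + Γ y u (Γ y v w) - Γ y v (Γ y u w)

/-- Torsion-freeness near `y` passes to the derivative of `Γ`; the derivative terms and the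
quadratic terms of the cyclic sum then cancel in pairs. -/
theorem flatCurvature_bianchi {Γ : H → H →L[ℝ] H →L[ℝ] H} {y : H}
    (hΓ : DifferentiableAt ℝ Γ y) (hsymm : ∀ᶠ z in 𝓝 y, ∀ u v, Γ z u v = Γ z v u) (u v w : H) :
    flatCurvature Γ y u v w + flatCurvature Γ y v w u + flatCurvature Γ y w u v = 0 := by
  have hD : ∀ a u v, fderiv ℝ Γ y a u v = fderiv ℝ Γ y a v u := by
    intro a u v
    have hd : ∀ u v, HasFDerivAt (fun z => Γ z u v) (((fderiv ℝ Γ y).flip u).flip v) y := by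
      intro u v
      have := ((hΓ.hasFDerivAt.clm_apply (hasFDerivAt_const u y))).clm_apply (hasFDerivAt_const v y)
      refine this.congr_fderiv ?_
      ext; simp
    have := ((hd u v).congr_of_eventuallyEq (hsymm.mono fun z hz => hz v u)).unique (hd v u)
    exact DFunLike.congr_fun this a
  have hs := hsymm.self_of_nhds
  simp only [flatCurvature]
  rw [hD u v w, hD v w u, hD w u v, hs v w, hs u w, hs v u]
  abel

/-- This is the symmetry of the second derivative of `G`, with both orders expanded by
differentiating the metric identity. -/
theorem flatCurvature_skew {G : H → H →L[ℝ] H →L[ℝ] ℝ} {Γ : H → H →L[ℝ] H →L[ℝ] H} {y : H}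
    (hG : ContDiffAt ℝ ∞ G y) (hΓ : DifferentiableAt ℝ Γ y)
    (hmetric : ∀ᶠ z in 𝓝 y, ∀ u v w, fderiv ℝ G z u v w = G z (Γ z u v) w + G z v (Γ z u w))
    (u v w x : H) :
    G y (flatCurvature Γ y u v w) x = -G y w (flatCurvature Γ y u v x) := by
  have hG1 : HasFDerivAt G (fderiv ℝ G y) y := (hG.differentiableAt (by simp)).hasFDerivAt
  have hG2 : HasFDerivAt (fderiv ℝ G) (fderiv ℝ (fderiv ℝ G) y) y :=
    ((hG.fderiv_right (m := 1) (by norm_cast)).differentiableAt (by simp)).hasFDerivAt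
  have hsym : IsSymmSndFDerivAt ℝ G y := hG.isSymmSndFDerivAt (by simpa using ENat.LEInfty.out)
  have hm := hmetric.self_of_nhds
  -- The metric identity holds near `y`, so it may be differentiated along the line `y + r • a` at
  -- `r = 0`.
  have second : ∀ a u, fderiv ℝ (fderiv ℝ G) y a u w x =
      fderiv ℝ G y a (Γ y u w) x + G y (fderiv ℝ Γ y a u w) x
      + (fderiv ℝ G y a w (Γ y u x) + G y w (fderiv ℝ Γ y a u x)) := by
    intro a u
    have hl : HasDerivAt (fun r : ℝ => y + r • a) a 0 := by
      simpa using ((hasDerivAt_id (0 : ℝ)).smul_const a).const_add y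
    have e0 : y + (0 : ℝ) • a = y := by simp
    have line : ∀ {F : Type _} [NormedAddCommGroup F] [NormedSpace ℝ F] {f : H → F}
        {f' : H →L[ℝ] F}, HasFDerivAt f f' y →
        HasDerivAt (fun r : ℝ => f (y + r • a)) (f' a) 0 := fun h =>
      HasFDerivAt.comp_hasDerivAt (0 : ℝ) (by rwa [e0]) hl
    have c : ∀ z : H, HasDerivAt (fun _ : ℝ => z) 0 0 := fun z => hasDerivAt_const _ _
    have hL := (((line hG2).clm_apply (c u)).clm_apply (c w)).clm_apply (c x)
    have hΓw := ((line hΓ.hasFDerivAt).clm_apply (c u)).clm_apply (c w)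
    have hΓx := ((line hΓ.hasFDerivAt).clm_apply (c u)).clm_apply (c x)
    have hR := (((line hG1).clm_apply hΓw).clm_apply (c x)).add
      (((line hG1).clm_apply (c w)).clm_apply hΓx)
    have hcont : Tendsto (fun r : ℝ => y + r • a) (𝓝 0) (𝓝 y) := by
      have := hl.continuousAt.tendsto
      rwa [e0] at this
    have := (hR.congr_of_eventuallyEq
      ((hcont.eventually hmetric).mono fun r hr => hr u w x)).unique hL
    simp only [e0, map_zero, add_zero, add_apply] at this
    exact this.symm
  have h1 := second u v
  have h2 := second v u
  rw [hsym.eq u v, h2, hm, hm, hm, hm] at h1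
  simp only [flatCurvature, map_add, map_sub, add_apply, sub_apply]
  linarith

theorem flatCurvature_symm {G : H → H →L[ℝ] H →L[ℝ] ℝ} {Γ : H → H →L[ℝ] H →L[ℝ] H} {y : H}
    (hG : ContDiffAt ℝ ∞ G y) (hΓ : DifferentiableAt ℝ Γ y)
    (hGsymm : ∀ u v, G y u v = G y v u)
    (hsymm : ∀ᶠ z in 𝓝 y, ∀ u v, Γ z u v = Γ z v u)
    (hmetric : ∀ᶠ z in 𝓝 y, ∀ u v w, fderiv ℝ G z u v w = G z (Γ z u v) w + G z v (Γ z u w))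
    (u v w : H) :
    G y (flatCurvature Γ y u v v) w = G y u (flatCurvature Γ y w v v) := by
  have h1 : ∀ a b c, flatCurvature Γ y a b c = -flatCurvature Γ y b a c := fun a b c => by
    simp only [flatCurvature]; abel
  have hskew := flatCurvature_skew hG hΓ hmetric
  have h := curvature_pair_symm (fun a b c d => G y (flatCurvature Γ y a b c) d)
    (fun a b c d => by rw [h1, map_neg, neg_apply])
    (fun a b c d => by rw [hskew, hGsymm])
    (fun a b c d => by
      rw [← add_apply, ← map_add, ← add_apply, ← map_add,
        flatCurvature_bianchi hΓ hsymm, map_zero, zero_apply]) u v v w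
  rw [h, hskew, h1 v w, map_neg, neg_neg]

end FlatCurvature

/-! ### Symmetry of the curvature operator on the manifold -/

section Curvature

variable {H : Type*} [NormedAddCommGroup H] [InnerProductSpace ℝ H]
  {M : Type*} [TopologicalSpace M] [ChartedSpace H M] [IsManifold 𝓘(ℝ, H) ∞ M]

namespace WeakRiemannianMetric

variable {g : WeakRiemannianMetric H M}

theorem HasSmoothLeviCivita.isLeviCivitaAt (hLC : g.HasSmoothLeviCivita) (x : M) {y : H}
    (hy : y ∈ (chartAt H x).target) :
    g.IsLeviCivitaAt (chartAt H x) y (g.christoffel (chartAt H x) y) := by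
  have h := (hLC _ (chart_mem_atlas H x)).1 y hy
  rw [christoffel, dif_pos h]
  exact h.choose_spec

theorem HasSmoothLeviCivita.curvature_symm (hLC : g.HasSmoothLeviCivita) (x : M)
    (u v w : TangentSpace 𝓘(ℝ, H) x) :
    g.inner x (g.curvature x u v v) w = g.inner x u (g.curvature x w v v) := by
  have he := IsManifold.chart_mem_maximalAtlas (I := 𝓘(ℝ, H)) (n := ∞) x
  have hx := mem_chart_source H x
  have htarget : (chartAt H x).target ∈ 𝓝 (chartAt H x x) :=
    (chartAt H x).open_target.mem_nhds (mem_chart_target H x)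
  have hΓ : DifferentiableAt ℝ (g.christoffel (chartAt H x)) (chartAt H x x) :=
    (((hLC _ (chart_mem_atlas H x)).2.contDiffAt htarget).differentiableAt (by simp))
  have key := flatCurvature_symm (g.contDiffAt_inChart x) hΓ (fun _ _ => g.inChart_symm _ _)
    (by filter_upwards [htarget] with y hy using (hLC.isLeviCivitaAt x hy).torsion_free)
    (by filter_upwards [htarget] with y hy using (hLC.isLeviCivitaAt x hy).metric)
    (coord (chartAt H x) x u) (coord (chartAt H x) x v) (coord (chartAt H x) x w)
  rw [g.symm x u]
  refine (g.inner_ofCoord he hx _ w).trans (key.trans ?_)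
  rw [g.inChart_symm]
  exact (g.inner_ofCoord he hx _ u).symm

end WeakRiemannianMetric

end Curvature

theorem hasDerivWithinAt_bilinear {H : Type*} [NormedAddCommGroup H] [NormedSpace ℝ H]
    {G : H → H →L[ℝ] H →L[ℝ] ℝ} {G' : H →L[ℝ] H →L[ℝ] H →L[ℝ] ℝ} {y v w : ℝ → H} {y' v' w' : H}
    {s : Set ℝ} {t : ℝ} (hG : HasFDerivAt G G' (y t)) (hy : HasDerivWithinAt y y' s t)
    (hv : HasDerivWithinAt v v' s t) (hw : HasDerivWithinAt w w' s t) :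
    HasDerivWithinAt (fun r => G (y r) (v r) (w r))
      (G' y' (v t) (w t) + G (y t) v' (w t) + G (y t) (v t) w') s t := by
  have h1 := hG.comp_hasDerivWithinAt t hy
  exact (h1.clm_apply hv).clm_apply hw

/-! ### Parallel transport is isometric and unique -/

section Parallel

variable {H : Type*} [NormedAddCommGroup H] [InnerProductSpace ℝ H]
  {M : Type*} [TopologicalSpace M] [ChartedSpace H M] [IsManifold 𝓘(ℝ, H) ∞ M]

omit [IsManifold 𝓘(ℝ, H) ∞ M] in
theorem hasDerivWithinAt_chart_comp {e : OpenPartialHomeomorph M H}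
    (he : e ∈ IsManifold.maximalAtlas 𝓘(ℝ, H) ∞ M) {c : ℝ → M} {s : Set ℝ} {t : ℝ}
    (hc : MDifferentiableWithinAt 𝓘(ℝ, ℝ) 𝓘(ℝ, H) c s t) (ht : c t ∈ e.source) :
    HasDerivWithinAt (fun r => e (c r)) (coord e (c t) (velocity c s t)) s t := by
  have h1 := ((mdifferentiable_of_mem_maximalAtlas he).mdifferentiableAt ht).hasMFDerivAt
  let L : ℝ →L[ℝ] H := (mfderiv 𝓘(ℝ, H) 𝓘(ℝ, H) e (c t)).comp
    (mfderivWithin 𝓘(ℝ, ℝ) 𝓘(ℝ, H) c s t)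
  have h2 : HasFDerivWithinAt (fun r => e (c r)) L s t :=
    hasMFDerivWithinAt_iff_hasFDerivWithinAt.1
      (h1.comp_hasMFDerivWithinAt t hc.hasMFDerivWithinAt)
  exact h2.hasDerivWithinAt

namespace WeakRiemannianMetric

variable {g : WeakRiemannianMetric H M}

/-- The inner product of parallel vector fields is constant. -/
theorem HasSmoothLeviCivita.inner_parallel (hLC : g.HasSmoothLeviCivita) {c : ℝ → M} {b : ℝ}
    (hc : ContMDiffOn 𝓘(ℝ, ℝ) 𝓘(ℝ, H) ∞ c (Icc 0 b)) {V W : ∀ t, TangentSpace 𝓘(ℝ, H) (c t)}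
    (hV : g.IsParallelAlong c (Icc 0 b) V) (hW : g.IsParallelAlong c (Icc 0 b) W) {t : ℝ}
    (ht : t ∈ Icc 0 b) : g.inner (c t) (V t) (W t) = g.inner (c 0) (V 0) (W 0) := by
  have key : ∀ t ∈ Icc 0 b, HasDerivWithinAt (fun r => g.inner (c r) (V r) (W r)) 0 (Icc 0 b) t := by
    intro t ht
    have he := IsManifold.chart_mem_maximalAtlas (I := 𝓘(ℝ, H)) (n := ∞) (c t)
    let e := chartAt H (c t)
    have hsrc : c t ∈ e.source := mem_chart_source H (c t)
    have hy := hasDerivWithinAt_chart_comp he ((hc t ht).mdifferentiableWithinAt (by simp)) hsrc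
    have hG : HasFDerivAt (g.inChart e) (fderiv ℝ (g.inChart e) (e (c t))) (e (c t)) :=
      ((g.contDiffAt_inChart (c t)).differentiableAt (by simp)).hasFDerivAt
    have h := hasDerivWithinAt_bilinear (y := fun r => e (c r)) hG hy (hV t ht) (hW t ht)
    have hm := (hLC.isLeviCivitaAt (c t) (mem_chart_target H (c t))).metric
    have hev : (fun r => g.inner (c r) (V r) (W r)) =ᶠ[𝓝[Icc 0 b] t]
        fun r => g.inChart e (e (c r)) (coord e (c r) (V r)) (coord e (c r) (W r)) := by
      filter_upwards [(hc t ht).continuousWithinAt.preimage_mem_nhdsWithin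
        (e.open_source.mem_nhds hsrc)] with r hr
      exact (g.inChart_apply he hr _ _).symm
    refine (h.congr_of_eventuallyEq hev (hev.self_of_nhdsWithin ht)).congr_deriv ?_
    rw [hm, map_neg, map_neg, neg_apply]
    ring
  have hb : 0 ≤ b := ht.1.trans ht.2
  refine constant_of_derivWithin_zero (fun s hs => (key s hs).differentiableWithinAt) ?_ t ht
  intro s hs
  have hs' : s ∈ Icc 0 b := Ico_subset_Icc_self hs
  exact (key s hs').derivWithin (uniqueDiffOn_Icc (hs.1.trans_lt hs.2) s hs')

theorem IsParallelAlong.sub {c : ℝ → M} {s : Set ℝ} {V W : ∀ t, TangentSpace 𝓘(ℝ, H) (c t)}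
    (hV : g.IsParallelAlong c s V) (hW : g.IsParallelAlong c s W) :
    g.IsParallelAlong c s fun t => V t - W t := by
  intro t ht
  simp only [coord_sub]
  refine ((hV t ht).sub (hW t ht)).congr_deriv ?_
  rw [map_sub]
  abel

section Transport

variable {c : ℝ → M} {b : ℝ}
  {P Q : ∀ t, TangentSpace 𝓘(ℝ, H) (c 0) ≃L[ℝ] TangentSpace 𝓘(ℝ, H) (c t)}

theorem HasSmoothLeviCivita.inner_transport (hLC : g.HasSmoothLeviCivita)
    (hc : ContMDiffOn 𝓘(ℝ, ℝ) 𝓘(ℝ, H) ∞ c (Icc 0 b)) (hP : g.IsParallelTransport c (Icc 0 b) P)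
    {t : ℝ} (ht : t ∈ Icc 0 b) (u v : TangentSpace 𝓘(ℝ, H) (c 0)) :
    g.inner (c t) (P t u) (P t v) = g.inner (c 0) u v := by
  rw [hLC.inner_parallel hc (hP.2 u) (hP.2 v) ht, hP.1, hP.1]

/-- The difference of two parallel fields with the same initial value has constant square `0`, so
positivity of the weak metric replaces a uniqueness theorem for the ODE. It is needed because each
Jacobi flow comes with its own transport. -/
theorem HasSmoothLeviCivita.transport_unique (hLC : g.HasSmoothLeviCivita)
    (hc : ContMDiffOn 𝓘(ℝ, ℝ) 𝓘(ℝ, H) ∞ c (Icc 0 b)) (hP : g.IsParallelTransport c (Icc 0 b) P)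
    (hQ : g.IsParallelTransport c (Icc 0 b) Q) {t : ℝ} (ht : t ∈ Icc 0 b) : P t = Q t := by
  ext u
  have h := (hP.2 u).sub (hQ.2 u)
  have h1 := hLC.inner_parallel hc h h ht
  simp only [hP.1, hQ.1, sub_self, map_zero] at h1
  by_contra hne
  exact (g.pos (c t) _ (sub_ne_zero.2 hne)).ne' h1

theorem HasSmoothLeviCivita.jacobiOperator_unique (hLC : g.HasSmoothLeviCivita)
    (hc : ContMDiffOn 𝓘(ℝ, ℝ) 𝓘(ℝ, H) ∞ c (Icc 0 b)) (hP : g.IsParallelTransport c (Icc 0 b) P)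
    (hQ : g.IsParallelTransport c (Icc 0 b) Q) {t : ℝ} (ht : t ∈ Icc 0 b) :
    g.jacobiOperator c (Icc 0 b) P t = g.jacobiOperator c (Icc 0 b) Q t := by
  funext u
  rw [jacobiOperator, jacobiOperator, hLC.transport_unique hc hP hQ ht]

theorem HasSmoothLeviCivita.jacobiOperator_symm (hLC : g.HasSmoothLeviCivita)
    (hc : ContMDiffOn 𝓘(ℝ, ℝ) 𝓘(ℝ, H) ∞ c (Icc 0 b)) (hP : g.IsParallelTransport c (Icc 0 b) P)
    {t : ℝ} (ht : t ∈ Icc 0 b) (u v : TangentSpace 𝓘(ℝ, H) (c 0)) :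
    g.inner (c 0) (g.jacobiOperator c (Icc 0 b) P t u) v =
      g.inner (c 0) u (g.jacobiOperator c (Icc 0 b) P t v) := by
  rw [← hLC.inner_transport hc hP ht, ← hLC.inner_transport hc hP ht u, jacobiOperator,
    jacobiOperator, ContinuousLinearEquiv.apply_symm_apply,
    ContinuousLinearEquiv.apply_symm_apply, hLC.curvature_symm]

end Transport

end WeakRiemannianMetric

end Parallel

/-! ### Tangent spaces and second fundamental form of a hypersurface -/

section Hypersurface

variable {H : Type*} [NormedAddCommGroup H] [InnerProductSpace ℝ H]
  {M : Type*} [TopologicalSpace M] [ChartedSpace H M]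

theorem hasDerivAt_line (z a : H) : HasDerivAt (fun r : ℝ => z + r • a) a 0 := by
  simpa using ((hasDerivAt_id (0 : ℝ)).smul_const a).const_add z

theorem tendsto_line (z a : H) : Tendsto (fun r : ℝ => z + r • a) (𝓝 0) (𝓝 z) := by
  simpa using (hasDerivAt_line z a).continuousAt.tendsto

/-- The derivative of a curve in a translate of a closed subspace lies in the subspace. -/
theorem mem_of_hasDerivAt {F : Submodule ℝ H} (hF : IsClosed (F : Set H)) {f : ℝ → H} {f' : H}
    (hf : HasDerivAt f f' 0) (h : ∀ᶠ t in 𝓝 (0 : ℝ), f t - f 0 ∈ F) : f' ∈ F := by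
  refine hF.mem_of_tendsto (hasDerivAt_iff_tendsto_slope.1 hf) ?_
  filter_upwards [h.filter_mono nhdsWithin_le_nhds] with t ht
  exact F.smul_mem _ ht

variable {φ : OpenPartialHomeomorph M H} (hφ : φ ∈ IsManifold.maximalAtlas 𝓘(ℝ, H) ∞ M)
  {S : Set M} {F : Submodule ℝ H} {p : M}

include hφ

/-- In the flattening chart the witness is the straight line through `z` in direction `a`. The base
point varies so that a constant `a` yields a tangent field along `S` near `p`. -/
theorem ofCoord_mem_tangentVectors (hS : ∀ y ∈ φ.source, (y ∈ S ↔ φ y - φ p ∈ F))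
    {z : H} (hz : z ∈ φ.target) (hzF : z - φ p ∈ F) {a : H} (ha : a ∈ F) :
    ofCoord φ z a ∈ tangentVectors (H := H) S (φ.symm z) := by
  have e0 : z + (0 : ℝ) • a = z := by simp
  have hsymm : ContMDiffAt 𝓘(ℝ, H) 𝓘(ℝ, H) ∞ φ.symm z := contMDiffAt_symm_of_mem_maximalAtlas hφ hz
  have hline : ContMDiffAt 𝓘(ℝ, ℝ) 𝓘(ℝ, H) ∞ (fun r : ℝ => z + r • a) 0 :=
    (contDiff_const.add (contDiff_id.smul contDiff_const)).contMDiff.contMDiffAt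
  refine ⟨fun r => φ.symm (z + r • a), ?_, ?_, by simp, ?_⟩
  · exact ContMDiffAt.comp (0 : ℝ) (by rwa [e0]) hline
  · filter_upwards [(tendsto_line z a).eventually (φ.open_target.mem_nhds hz)] with r hr
    rw [hS _ (φ.map_target hr), φ.right_inv hr, add_sub_right_comm]
    exact F.add_mem hzF (F.smul_mem _ ha)
  · have hz' : z + (0 : ℝ) • a ∈ φ.target := by rwa [e0]
    have h1 := ((mdifferentiable_of_mem_maximalAtlas hφ).mdifferentiableAt_symm hz').hasMFDerivAt
    have h2 := (hasDerivAt_line z a).hasFDerivAt.hasMFDerivAt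
    have h3 := (h1.comp (0 : ℝ) h2).mfderiv
    have h4 : mfderiv 𝓘(ℝ, ℝ) 𝓘(ℝ, H) (fun r : ℝ => φ.symm (z + r • a)) 0 (1 : ℝ)
        = ofCoord φ (z + (0 : ℝ) • a) ((1 : ℝ) • a) := DFunLike.congr_fun h3 (1 : ℝ)
    rw [one_smul, e0] at h4
    exact h4.symm

theorem coord_mem_of_mem_tangentVectors (hS : ∀ y ∈ φ.source, (y ∈ S ↔ φ y - φ p ∈ F))
    (hF : IsClosed (F : Set H)) (hp : p ∈ φ.source) {v : TangentSpace 𝓘(ℝ, H) p}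
    (hv : v ∈ tangentVectors (H := H) S p) : coord φ p v ∈ F := by
  obtain ⟨γ, hγ, hγS, rfl, rfl⟩ := hv
  have h := hasDerivWithinAt_chart_comp hφ (c := γ) (s := univ) (t := 0)
    (hγ.mdifferentiableAt (by simp)).mdifferentiableWithinAt hp
  rw [hasDerivWithinAt_univ] at h
  have hv : velocity (H := H) γ univ 0 = mfderiv 𝓘(ℝ, ℝ) 𝓘(ℝ, H) γ 0 (1 : ℝ) := by
    rw [velocity, mfderivWithin_univ]
  rw [hv] at h
  refine mem_of_hasDerivAt hF h ?_
  filter_upwards [hγS, hγ.continuousAt.preimage_mem_nhds (φ.open_source.mem_nhds hp)] with t h1 h2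
  exact (hS _ h2).1 h1

theorem coord_ofCoord_eq_fderiv {e : OpenPartialHomeomorph M H}
    (he : e ∈ IsManifold.maximalAtlas 𝓘(ℝ, H) ∞ M) {z : H} (hz : z ∈ φ.target)
    (hze : φ.symm z ∈ e.source) (a : H) :
    coord e (φ.symm z) (ofCoord φ z a) = fderiv ℝ (fun z => e (φ.symm z)) z a := by
  have h1 := ((mdifferentiable_of_mem_maximalAtlas he).mdifferentiableAt hze).hasMFDerivAt
  have h2 := ((mdifferentiable_of_mem_maximalAtlas hφ).mdifferentiableAt_symm hz).hasMFDerivAt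
  have h3 := (h1.comp z h2).mfderiv
  rw [mfderiv_eq_fderiv] at h3
  exact (DFunLike.congr_fun h3 a).symm

omit hφ

variable [IsManifold 𝓘(ℝ, H) ∞ M] {g : WeakRiemannianMetric H M}
  {N : ∀ x : M, TangentSpace 𝓘(ℝ, H) x}

namespace WeakRiemannianMetric

/-- Every vector is tangent to the hypersurface up to a multiple of the normal vector. -/
theorem IsNormalField.sub_smul_mem (hN : g.IsNormalField S N) (hS : IsHypersurface (H := H) S)
    (hp : p ∈ S) {V : Submodule ℝ (TangentSpace 𝓘(ℝ, H) p)}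
    (hV : tangentVectors (H := H) S p = V) (x : TangentSpace 𝓘(ℝ, H) p) :
    x - (g.inner p x (N p) / g.inner p (N p) (N p)) • N p ∈ V := by
  obtain ⟨φ, hφ, F, hF, hrank, hsrc, hSF⟩ := hS p hp
  have htan : ∀ v : TangentSpace 𝓘(ℝ, H) p, coord φ p v ∈ F → v ∈ V := by
    intro v hv
    have h := ofCoord_mem_tangentVectors hφ hSF (φ.map_source hsrc)
      (by rw [sub_self]; exact F.zero_mem) hv
    rw [φ.left_inv hsrc, ofCoord_coord hφ hsrc, hV] at h
    exact h
  have hort : ∀ v ∈ V, g.inner p (N p) v = 0 := fun v hv =>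
    hN.normal p hp v (by rw [hV]; exact hv)
  have hNN := g.pos p (N p) (hN.ne_zero p hp)
  -- Were the normal vector tangent, it would be orthogonal to itself. Hence its class spans the
  -- one-dimensional quotient.
  have hn : F.mkQ (coord φ p (N p)) ≠ 0 := fun h =>
    hNN.ne' (hort _ (htan _ ((Submodule.Quotient.mk_eq_zero F).1 h)))
  obtain ⟨r, hr⟩ := (finrank_eq_one_iff_of_nonzero' _ hn).1 hrank (F.mkQ (coord φ p x))
  have hmem : x - r • N p ∈ V := by
    refine htan _ ?_
    rw [coord_sub, coord_smul, ← Submodule.Quotient.mk_eq_zero F]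
    rw [← map_smul] at hr
    exact sub_eq_zero.2 hr.symm
  have h0 := hort _ hmem
  rw [map_sub, map_smul, smul_eq_mul, sub_eq_zero, g.symm p (N p) x] at h0
  rwa [h0, mul_div_assoc, div_self hNN.ne', mul_one]

/-- This guarantees that the `fderivWithin` in `covDerivOn` is a genuine derivative and not the
default value `0`. -/
theorem IsNormalField.differentiableWithinAt (hN : g.IsNormalField S N) (hp : p ∈ S) :
    DifferentiableWithinAt ℝ
      (fun y => coord (chartAt H p) ((chartAt H p).symm y) (N ((chartAt H p).symm y)))
      ((chartAt H p).target ∩ (chartAt H p).symm ⁻¹' S) (chartAt H p p) := by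
  set e := chartAt H p with he
  have h := ((Bundle.contMDiffWithinAt_totalSpace).1 (hN.smooth p hp)).2
  have hx : e.symm (e p) = p := e.left_inv (mem_chart_source H p)
  have hsymm : ContMDiffAt 𝓘(ℝ, H) 𝓘(ℝ, H) ∞ e.symm (e p) :=
    contMDiffAt_symm_of_mem_maximalAtlas (IsManifold.chart_mem_maximalAtlas p)
      (mem_chart_target H p)
  rw [← hx] at h
  have h2 := h.comp (t := S) (e p) (s := e.target ∩ e.symm ⁻¹' S) hsymm.contMDiffWithinAt
    fun y hy => hy.2
  rw [hx] at h2
  have hval : ∀ y ∈ e.target, coord e (e.symm y) (N (e.symm y)) =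
      (trivializationAt H (TangentSpace 𝓘(ℝ, H)) p
        (⟨e.symm y, N (e.symm y)⟩ : TangentBundle 𝓘(ℝ, H) M)).2 := by
    intro y hy
    have hy' : e.symm y ∈ (chartAt H p).source := e.map_target hy
    have hL := DFunLike.congr_fun
      (TangentBundle.continuousLinearMapAt_trivializationAt (I := 𝓘(ℝ, H)) hy') (N (e.symm y))
    rw [Bundle.Trivialization.continuousLinearMapAt_apply,
      Bundle.Trivialization.coe_linearMapAt_of_mem _ hy'] at hL
    simp only [extChartAt, mfld_simps] at hL
    exact hL.symm
  exact (h2.contDiffWithinAt.differentiableWithinAt (by simp)).congr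
    (fun y hy => hval y hy.1) (hval _ (mem_chart_target H p))

/-- With `χ` the change from a flattening chart to the chart at `p`, constant vectors of `F` give
tangent fields `Dχ a'`. Differentiating `G (N, Dχ a') = 0` along `a` expresses `G (∇_u N, w)` as
minus `G (N, Γ (u, w) + D²χ (a, a'))`, which is symmetric. -/
theorem HasSmoothLeviCivita.covDerivOn_symm (hLC : g.HasSmoothLeviCivita)
    (hN : g.IsNormalField S N) (hS : IsHypersurface (H := H) S) (hp : p ∈ S)
    {u w : TangentSpace 𝓘(ℝ, H) p} (hu : u ∈ tangentVectors (H := H) S p)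
    (hw : w ∈ tangentVectors (H := H) S p) :
    g.inner p (g.covDerivOn S N p u) w = g.inner p (g.covDerivOn S N p w) u := by
  obtain ⟨φ, hφ, F, hF, hrank, hsrc, hSF⟩ := hS p hp
  have he := IsManifold.chart_mem_maximalAtlas (I := 𝓘(ℝ, H)) (n := ∞) p
  have hpe := mem_chart_source H p
  have hD := (hN.differentiableWithinAt hp).hasFDerivWithinAt
  have hG : HasFDerivAt (g.inChart (chartAt H p)) (fderiv ℝ (g.inChart (chartAt H p))
      (chartAt H p p)) (chartAt H p p) :=
    ((g.contDiffAt_inChart p).differentiableAt (by simp)).hasFDerivAt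
  have hm := (hLC.isLeviCivitaAt p (mem_chart_target H p)).metric
  have htors := (hLC.isLeviCivitaAt p (mem_chart_target H p)).torsion_free
  have hinner : ∀ u w : TangentSpace 𝓘(ℝ, H) p, g.inner p (g.covDerivOn S N p u) w =
      g.inChart (chartAt H p) (chartAt H p p) _ (coord (chartAt H p) p w) := fun u w =>
    g.inner_ofCoord he hpe _ w
  rw [hinner, hinner]
  set n : H → H := fun y => coord (chartAt H p) ((chartAt H p).symm y)
    (N ((chartAt H p).symm y)) with hn
  set D := fderivWithin ℝ n ((chartAt H p).target ∩ (chartAt H p).symm ⁻¹' S) (chartAt H p p)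
  set e := chartAt H p with hedef
  set G := g.inChart e
  have hNp : n (e p) = coord e p (N p) := congrArg (fun x => coord e x (N x)) (e.left_inv hpe)
  set χ : H → H := fun z => e (φ.symm z) with hχ
  have hz0 : φ p ∈ φ.target := φ.map_source hsrc
  have hφp : φ.symm (φ p) = p := φ.left_inv hsrc
  have hχ0 : χ (φ p) = e p := by rw [hχ]; simp only [hφp]
  have hχd : ContDiffAt ℝ ∞ χ (φ p) := by
    have h1 : ContMDiffAt 𝓘(ℝ, H) 𝓘(ℝ, H) ∞ φ.symm (φ p) :=
      contMDiffAt_symm_of_mem_maximalAtlas hφ hz0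
    have h2 : ContMDiffAt 𝓘(ℝ, H) 𝓘(ℝ, H) ∞ e (φ.symm (φ p)) :=
      contMDiffAt_of_mem_maximalAtlas he (by rwa [hφp])
    exact (h2.comp (φ p) h1).contDiffAt
  have hχ1 : HasFDerivAt χ (fderiv ℝ χ (φ p)) (φ p) :=
    (hχd.differentiableAt (by simp)).hasFDerivAt
  have hχ2 : HasFDerivAt (fderiv ℝ χ) (fderiv ℝ (fderiv ℝ χ) (φ p)) (φ p) :=
    ((hχd.fderiv_right (m := 1) (by norm_cast)).differentiableAt (by simp)).hasFDerivAt
  have hχs : IsSymmSndFDerivAt ℝ χ (φ p) := hχd.isSymmSndFDerivAt (by simpa using ENat.LEInfty.out)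
  have hcoord : ∀ v : TangentSpace 𝓘(ℝ, H) p, fderiv ℝ χ (φ p) (coord φ p v) = coord e p v := by
    intro v
    have h := coord_ofCoord_eq_fderiv hφ he hz0 (by rwa [hφp]) (coord φ p v)
    rw [hφp, ofCoord_coord hφ hsrc] at h
    exact h.symm
  have hnear : ∀ᶠ z in 𝓝 (φ p), z ∈ φ.target ∧ φ.symm z ∈ e.source :=
    (φ.open_target.eventually_mem hz0).and
      ((φ.symm.continuousAt hz0).preimage_mem_nhds (e.open_source.mem_nhds (by rwa [hφp])))
  have key : ∀ u w : TangentSpace 𝓘(ℝ, H) p, u ∈ tangentVectors (H := H) S p →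
      w ∈ tangentVectors (H := H) S p →
      fderiv ℝ G (e p) (coord e p u) (n (e p)) (coord e p w) + G (e p) (D (coord e p u)) (coord e p w)
        + G (e p) (n (e p)) (fderiv ℝ (fderiv ℝ χ) (φ p) (coord φ p u) (coord φ p w)) = 0 := by
    intro u w hu hw
    set a := coord φ p u with ha
    set a' := coord φ p w with ha'
    have haF : a ∈ F := coord_mem_of_mem_tangentVectors hφ hSF hF hsrc hu
    have haF' : a' ∈ F := coord_mem_of_mem_tangentVectors hφ hSF hF hsrc hw
    have e0 : φ p + (0 : ℝ) • a = φ p := by simp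
    have hl := hasDerivAt_line (φ p) a
    have hy : HasDerivAt (fun r : ℝ => χ (φ p + r • a)) (coord e p u) 0 := by
      rw [← hcoord]
      exact hχ1.comp_hasDerivAt_of_eq (0 : ℝ) hl e0.symm
    have hX : HasDerivAt (fun r : ℝ => fderiv ℝ χ (φ p + r • a) a')
        (fderiv ℝ (fderiv ℝ χ) (φ p) a a') 0 := by
      have h1 : HasDerivAt (fun r : ℝ => fderiv ℝ χ (φ p + r • a))
          (fderiv ℝ (fderiv ℝ χ) (φ p) a) 0 :=
        hχ2.comp_hasDerivAt_of_eq (0 : ℝ) hl e0.symm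
      simpa using h1.clm_apply (hasDerivAt_const (0 : ℝ) a')
    have hev : ∀ᶠ r : ℝ in 𝓝 0, φ p + r • a ∈ φ.target ∧ φ.symm (φ p + r • a) ∈ e.source :=
      (tendsto_line (φ p) a).eventually hnear
    have hmemF : ∀ r : ℝ, φ p + r • a - φ p ∈ F := fun r => by
      rw [add_sub_cancel_left]; exact F.smul_mem _ haF
    have hinS : ∀ᶠ r : ℝ in 𝓝 0, χ (φ p + r • a) ∈ e.target ∩ e.symm ⁻¹' S := by
      filter_upwards [hev] with r hr
      refine ⟨e.map_source hr.2, ?_⟩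
      rw [mem_preimage, hχ]
      simp only
      rw [e.left_inv hr.2, hSF _ (φ.map_target hr.1), φ.right_inv hr.1]
      exact hmemF r
    -- `D` is a derivative within `S` only, but the curve stays in `S` for all small `r`, so the
    -- composite has a two-sided derivative.
    have hnd : HasDerivAt (fun r : ℝ => n (χ (φ p + r • a))) (D (coord e p u)) 0 := by
      have h := hD.comp_hasDerivWithinAt_of_eq (0 : ℝ) hy.hasDerivWithinAt
        (s := (fun r : ℝ => χ (φ p + r • a)) ⁻¹' (e.target ∩ e.symm ⁻¹' S)) (fun r hr => hr)
        (by rw [e0, hχ0])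
      exact h.hasDerivAt hinS
    have hzero : ∀ᶠ r : ℝ in 𝓝 0,
        G (χ (φ p + r • a)) (n (χ (φ p + r • a))) (fderiv ℝ χ (φ p + r • a) a') = 0 := by
      filter_upwards [hev] with r hr
      rw [← coord_ofCoord_eq_fderiv hφ he hr.1 hr.2]
      have h1 : n (χ (φ p + r • a)) = coord e (φ.symm (φ p + r • a)) (N (φ.symm (φ p + r • a))) :=
        congrArg (fun x => coord e x (N x)) (e.left_inv hr.2)
      rw [h1]
      refine (g.inChart_apply he hr.2 _ _).trans ?_
      refine hN.normal _ ?_ _ (ofCoord_mem_tangentVectors hφ hSF hr.1 (hmemF r) haF')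
      rw [hSF _ (φ.map_target hr.1), φ.right_inv hr.1]
      exact hmemF r
    have hder := hasDerivWithinAt_bilinear (G := G) (y := fun r : ℝ => χ (φ p + r • a)) (s := univ)
      (G' := fderiv ℝ G (e p)) (t := 0) (by rw [e0, hχ0]; exact hG) hy.hasDerivWithinAt
      hnd.hasDerivWithinAt hX.hasDerivWithinAt
    rw [hasDerivWithinAt_univ, e0, hχ0, hcoord] at hder
    exact hder.unique ((hasDerivAt_const (0 : ℝ) (0 : ℝ)).congr_of_eventuallyEq hzero)
  have h1 := key u w hu hw
  have h2 := key w u hw hu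
  rw [hm, hNp] at h1 h2
  rw [hχs.eq, htors (coord e p u) (coord e p w)] at h1
  rw [map_add, map_add, add_apply, add_apply]
  linarith

end WeakRiemannianMetric

end Hypersurface

/-! ### Initial data of the flows, and the norm bound for a strong metric -/

section InitialData

variable {E : Type*} [NormedAddCommGroup E] [NormedSpace ℝ E]

/-- The initial data of the Jacobi flows of two hypersurfaces with the tangent space `V` and the
normal vector `ξ`. -/
theorem IsInitialPair.of_decomposition {G : E →L[ℝ] E →L[ℝ] ℝ} (hsymm : ∀ x y, G x y = G y x)
    {V : Submodule ℝ E} {ξ : E} (hort : ∀ v ∈ V, G ξ v = 0)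
    (hdec : ∀ x, ∃ v ∈ V, ∃ r : ℝ, x = v + r • ξ) {P L L' : E →L[ℝ] E}
    (hP : ∀ v ∈ V, P v = v) (hPξ : P ξ = 0) (hL : ∀ v ∈ V, L v ∈ V) (hL' : ∀ v ∈ V, L' v ∈ V)
    (hLξ : L ξ = ξ) (hLξ' : L' ξ = ξ) (hLs : ∀ v ∈ V, ∀ w ∈ V, G (L v) w = G (L w) v)
    (hlt : ∀ v ∈ V, v ≠ 0 → G (L v) v < G (L' v) v) : IsInitialPair G P L L' := by
  have hort' : ∀ v ∈ V, G v ξ = 0 := fun v hv => by rw [hsymm, hort v hv]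
  have hPL := fun v hv => hP _ (hL v hv)
  have hPL' := fun v hv => hP _ (hL' v hv)
  have hs : ∀ v ∈ V, ∀ w ∈ V, G v (L w) = G (L v) w := fun v hv w hw => by
    rw [hLs v hv w hw, hsymm]
  constructor
  · intro x
    obtain ⟨v, hv, r, rfl⟩ := hdec x
    simp [hP v hv, hPξ]
  · intro x
    obtain ⟨v, hv, r, rfl⟩ := hdec x
    simp [hP v hv, hPξ, hPL v hv, hLξ]
  · intro x
    obtain ⟨v, hv, r, rfl⟩ := hdec x
    simp [hP v hv, hPξ, hPL v hv, hLξ]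
  · intro x
    obtain ⟨v, hv, r, rfl⟩ := hdec x
    simp [hPL v hv, hPL' v hv, hLξ, hLξ']
  · intro x
    obtain ⟨v, hv, r, rfl⟩ := hdec x
    simp [hP v hv, hPξ, hLξ, hLξ']
  · intro x y
    obtain ⟨v, hv, r, rfl⟩ := hdec x
    obtain ⟨w, hw, q, rfl⟩ := hdec y
    simp [hP v hv, hP w hw, hPξ, hLξ, hort w hw, hort' v hv, hs v hv w hw]
  · intro x y
    obtain ⟨v, hv, r, rfl⟩ := hdec x
    obtain ⟨w, hw, q, rfl⟩ := hdec y
    simp [hP v hv, hP w hw, hPξ, hLξ, hLξ', hort w hw, hort' v hv, hs v hv w hw,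
      hort' _ (hL v hv), hort' _ (hL' v hv)]
  · intro x hx
    obtain ⟨v, hv, r, rfl⟩ := hdec x
    have hv0 : v ≠ 0 := fun h => hx (by simp [h, hPξ])
    have := hlt v hv hv0
    simp only [map_add, map_smul, sub_apply, hLξ, hLξ', sub_self, smul_zero, add_zero, map_sub,
      hort' _ (hL v hv), hort' _ (hL' v hv)]
    linarith [hort' _ (hL v hv)]

/-- An inner product whose unit ball is bounded dominates the norm. -/
theorem exists_sq_norm_le {G : E →L[ℝ] E →L[ℝ] ℝ} (hpos : ∀ x, x ≠ 0 → 0 < G x x)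
    (hbdd : Bornology.IsVonNBounded ℝ {x | G x x < 1}) : ∃ C, ∀ x, ‖x‖ ^ 2 ≤ C * G x x := by
  obtain ⟨K, hK⟩ := ((NormedSpace.isVonNBounded_iff ℝ).1 hbdd).exists_norm_le
  refine ⟨2 * K ^ 2, fun x => ?_⟩
  by_cases hx : x = 0
  · simp [hx]
  have hs := hpos x hx
  have hsq : (√(2 * G x x)) ^ 2 = 2 * G x x := Real.sq_sqrt (by positivity)
  have hr : 0 < √(2 * G x x) := Real.sqrt_pos.2 (by positivity)
  -- The factor `2` puts the rescaled vector at `G`-value `1 / 2`, strictly inside the open unit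
  -- ball.
  have h1 := hK ((√(2 * G x x))⁻¹ • x) (by
    simp only [mem_ofPred_eq, map_smul, smul_apply, smul_eq_mul]
    rw [← mul_assoc, ← sq, inv_pow, hsq, mul_inv, mul_assoc, inv_mul_cancel₀ hs.ne']
    norm_num)
  rw [norm_smul, norm_inv, Real.norm_of_nonneg hr.le, inv_mul_le_iff₀ hr] at h1
  calc ‖x‖ ^ 2 ≤ (√(2 * G x x) * K) ^ 2 := pow_le_pow_left₀ (norm_nonneg x) h1 2
    _ = _ := by rw [mul_pow, hsq]; ring

end InitialData

/-! ### The Weingarten operator and its quadratic form -/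

section Weingarten

variable {H : Type*} [NormedAddCommGroup H] [InnerProductSpace ℝ H]
  {M : Type*} [TopologicalSpace M] [ChartedSpace H M] [IsManifold 𝓘(ℝ, H) ∞ M]
  {g : WeakRiemannianMetric H M} {S : Set M} {N : ∀ x : M, TangentSpace 𝓘(ℝ, H) x} {p : M}

namespace WeakRiemannianMetric

theorem IsNormalField.weingarten_mem (hN : g.IsNormalField S N) (hS : IsHypersurface (H := H) S)
    (hp : p ∈ S) {V : Submodule ℝ (TangentSpace 𝓘(ℝ, H) p)}
    (hV : tangentVectors (H := H) S p = V) (v : TangentSpace 𝓘(ℝ, H) p) :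
    g.weingarten S N p v ∈ V :=
  V.neg_mem (hN.sub_smul_mem hS hp hV _)

theorem IsNormalField.inner_weingarten (hN : g.IsNormalField S N) (hp : p ∈ S)
    (v : TangentSpace 𝓘(ℝ, H) p) {w : TangentSpace 𝓘(ℝ, H) p}
    (hw : w ∈ tangentVectors (H := H) S p) :
    g.inner p (g.weingarten S N p v) w = -g.inner p (g.covDerivOn S N p v) w := by
  rw [weingarten, map_neg, neg_apply, map_sub, sub_apply, map_smul, smul_apply,
    hN.normal p hp w hw, smul_zero, sub_zero]

end WeakRiemannianMetric

end Weingarten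

end WeakRiem

/-! ### The comparison theorem -/

open WeakRiem in
theorem corollary3p3
    {H : Type*} [NormedAddCommGroup H] [InnerProductSpace ℝ H] [CompleteSpace H]
    {M : Type*} [TopologicalSpace M] [ChartedSpace H M] [IsManifold 𝓘(ℝ, H) ∞ M]
    (g : WeakRiemannianMetric H M) (hLC : g.HasSmoothLeviCivita)
    (S S' : Set M) (hS : IsHypersurface (H := H) S) (hS' : IsHypersurface (H := H) S')
    (N N' : ∀ x : M, TangentSpace 𝓘(ℝ, H) x)
    (hN : g.IsNormalField S N) (hN' : g.IsNormalField S' N')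
    (b : ℝ) (hb : 0 < b) (c : ℝ → M) (hc : g.IsGeodesicOn c (Icc 0 b))
    (hpS : c 0 ∈ S) (hpS' : c 0 ∈ S')
    (V : Submodule ℝ (TangentSpace 𝓘(ℝ, H) (c 0)))
    (hV : IsClosed (V : Set (TangentSpace 𝓘(ℝ, H) (c 0))))
    (hVS : tangentVectors (H := H) S (c 0) = V) (hVS' : tangentVectors (H := H) S' (c 0) = V)
    (hcN : velocity c (Icc 0 b) 0 = N (c 0)) (hcN' : velocity c (Icc 0 b) 0 = N' (c 0))
    (hlt : ∀ X ∈ V, X ≠ 0 →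
      g.inner (c 0) (g.covDerivOn S N (c 0) X) X < g.inner (c 0) (g.covDerivOn S' N' (c 0) X) X)
    (T T' : ℝ → H →L[ℝ] H)
    (hT : g.IsJacobiFlow c b S N T) (hT' : g.IsJacobiFlow c b S' N' T')
    (hinv : ∀ t ∈ Ioo 0 b, (T t).IsInvertible) :
    (∀ t ∈ Ioo 0 b, Function.Injective (T' t)) ∧
    (g.IsStrong →
      BijOn (fun X => g.weingarten S N (c 0) X - g.weingarten S' N' (c 0) X) V V →
      ∀ t ∈ Ioo 0 b, (T' t).IsInvertible) := by
  obtain ⟨P, hP, T₁, T₂, hd, hd₁, heq, hv, hw⟩ := hT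
  obtain ⟨Q, hQ, U₁, U₂, hdU, hdU₁, heqU, hvU, hwU⟩ := hT'
  let G : H →L[ℝ] H →L[ℝ] ℝ := g.inner (c 0)
  let F : Submodule ℝ H := V
  let R : ℝ → H → H := fun t u => g.jacobiOperator c (Icc 0 b) P t u
  have hsol : IsJacobiSolution R b T T₁ T₂ := ⟨hd, hd₁, heq⟩
  -- By uniqueness of parallel transport both flows solve the same equation.
  have hsol' : IsJacobiSolution R b T' U₁ U₂ := ⟨hdU, hdU₁, fun t ht u =>
    (heqU t ht u).trans <| congrArg (fun A : H → H => -A (T' t u))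
      (hLC.jacobiOperator_unique hc.1 hQ hP ht)⟩
  have hsymm : ∀ x y : H, G x y = G y x := g.symm (c 0)
  have hpos : ∀ x : H, x ≠ 0 → 0 < G x x := g.pos (c 0)
  have hR : ∀ t ∈ Icc 0 b, ∀ x y, G (R t x) y = G x (R t y) := fun t ht x y =>
    hLC.jacobiOperator_symm hc.1 hP ht x y
  let ξ : H := N (c 0)
  have hξ' : N' (c 0) = ξ := hcN'.symm.trans hcN
  have hmem : ∀ v ∈ F, v ∈ tangentVectors (H := H) S (c 0) := fun v h => by rw [hVS]; exact h
  have hmem' : ∀ v ∈ F, v ∈ tangentVectors (H := H) S' (c 0) := fun v h => by rw [hVS']; exact h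
  have hort : ∀ v ∈ F, G ξ v = 0 := fun v h => hN.normal _ hpS v (hmem v h)
  have hdec : ∀ x, ∃ v ∈ F, ∃ r : ℝ, x = v + r • ξ := fun x =>
    ⟨_, hN.sub_smul_mem hS hpS hVS x, _, (sub_add_cancel x _).symm⟩
  have hTV : ∀ v ∈ F, T 0 v = v := fun v h => (hv v (hmem v h)).1
  have hUV : ∀ v ∈ F, T' 0 v = v := fun v h => (hvU v (hmem' v h)).1
  have hTξ := hw ξ fun v h => hN.normal _ hpS v h
  have hUξ := hwU ξ fun v h => by rw [← hξ']; exact hN'.normal _ hpS' v h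
  have hLV : ∀ v ∈ F, T₁ 0 v = -g.weingarten S N (c 0) v := fun v h => (hv v (hmem v h)).2
  have hLV' : ∀ v ∈ F, U₁ 0 v = -g.weingarten S' N' (c 0) v := fun v h => (hvU v (hmem' v h)).2
  have hG : ∀ v ∈ F, ∀ w ∈ F, G (T₁ 0 v) w = g.inner (c 0) (g.covDerivOn S N (c 0) v) w := by
    intro v h w h'
    rw [hLV v h]
    exact (map_neg (G.flip w) _).trans (neg_eq_iff_eq_neg.2 (hN.inner_weingarten hpS v (hmem w h')))
  have hG' : ∀ v ∈ F, ∀ w ∈ F, G (U₁ 0 v) w = g.inner (c 0) (g.covDerivOn S' N' (c 0) v) w := by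
    intro v h w h'
    rw [hLV' v h]
    exact (map_neg (G.flip w) _).trans
      (neg_eq_iff_eq_neg.2 (hN'.inner_weingarten hpS' v (hmem' w h')))
  have hLs : ∀ v ∈ F, ∀ w ∈ F, G (T₁ 0 v) w = G (T₁ 0 w) v := fun v h w h' => by
    rw [hG v h w h', hG w h' v h]
    exact hLC.covDerivOn_symm hN hS hpS (hmem v h) (hmem w h')
  have hLs' : ∀ v ∈ F, ∀ w ∈ F, G (U₁ 0 v) w = G (U₁ 0 w) v := fun v h w h' => by
    rw [hG' v h w h', hG' w h' v h]
    exact hLC.covDerivOn_symm hN' hS' hpS' (hmem' v h) (hmem' w h')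
  have hLmem : ∀ v ∈ F, T₁ 0 v ∈ F := fun v h => by
    rw [hLV v h]
    exact F.neg_mem (hN.weingarten_mem hS hpS hVS v)
  have hLmem' : ∀ v ∈ F, U₁ 0 v ∈ F := fun v h => by
    rw [hLV' v h]
    exact F.neg_mem (hN'.weingarten_mem hS' hpS' hVS' v)
  have hI : IsInitialPair G (T 0) (T₁ 0) (U₁ 0) :=
    IsInitialPair.of_decomposition hsymm hort hdec hTV hTξ.1 hLmem hLmem' hTξ.2 hUξ.2 hLs
      fun v h h0 => by
        rw [hG v h v h, hG' v h v h]
        exact hlt v h h0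
  have h0 : T' 0 = T 0 := by
    ext x
    obtain ⟨v, h, r, rfl⟩ := hdec x
    rw [map_add, map_add, map_smul, map_smul, hTV v h, hUV v h, hTξ.1, hUξ.1]
  refine ⟨fun t ht => hsol.injective hb hsol' hpos hR h0 hI hinv ht, fun hstrong hbij t ht => ?_⟩
  obtain ⟨C, hC⟩ := exists_sq_norm_le hpos (hstrong (c 0))
  refine hsol.isInvertible hb hsol' hpos hR h0 hI hinv hC F hV ?_ ?_ ?_ ht
  · intro x hx
    obtain ⟨v, h, r, rfl⟩ := hdec x
    have h1 := hx v h
    rw [map_add, map_smul, hsymm v ξ, hort v h, smul_zero, add_zero] at h1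
    have hv0 : v = 0 := by
      by_contra hne
      exact (hpos v hne).ne' h1
    rw [hv0, zero_add, map_smul, hTξ.1, smul_zero]
  · refine BijOn.congr (f₁ := fun X : H => g.weingarten S N (c 0) X - g.weingarten S' N' (c 0) X)
      hbij fun v h => ?_
    rw [sub_apply, hLV v h, hLV' v h]
    exact (neg_sub_neg _ _).symm
  -- The symmetry extends from `V` to the whole space because both initial velocities fix `ξ` and
  -- preserve `V`, so their difference kills `ξ` and has values orthogonal to it.
  · intro x y
    obtain ⟨v, h, r, rfl⟩ := hdec x
    obtain ⟨w, h', q, rfl⟩ := hdec y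
    have hort' : ∀ v ∈ F, G v ξ = 0 := fun v h => by rw [hsymm, hort v h]
    simp [hTξ.2, hUξ.2, hort' _ (hLmem v h), hort' _ (hLmem' v h), hort' _ (hLmem w h'),
      hort' _ (hLmem' w h'), hLs v h w h', hLs' v h w h']
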